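/- Let $(b_i)_i,(h_i)_i$ be positive loss weights, and let $(\sigma_{p,i})_i,(\sigma_{f,i})_i$ be positive variances. Put $\tilde b_i=b_i/(b_i+h_i)$, and let $\phi,\Phi,\Phi^{-1}$ be the standard normal density, distribution function and quantile function. Assume (A1) $0<\inf_i\tilde b_i\le\sup_i\tilde b_i<1$ and $\sup_i(b_i+h_i)<\infty$; (A3) $\sup_i\sigma_{p,i}/\sigma_{f,i}<1/(4e)$, $\sup_i\sigma_{f,i}<\infty$ and $\inf_i\sigma_{p,i}>0$. Let $G(w,\beta)=\phi(w)+w\Phi(w)-\beta w$. For $\tau\in[0,\infty]$ let $\alpha_i(\tau)=\tau/(\tau+\sigma_{p,i})$, with $\alpha_i(\infty)=1$, and $$c_i(\tau)=\sqrt{\frac{\sigma_{f,i}+\alpha_i(\tau)\sigma_{p,i}}{\sigma_{f,i}+\alpha_i(\tau)^2\sigma_{p,i}}}\;\Phi^{-1}(\tilde b_i),\qquad d_i(\tau)=-\frac{1-\alpha_i(\tau)}{\sqrt{\sigma_{f,i}+\sigma_{p,i}\alpha_i(\tau)^2}} .$$ Let $X_i\sim N(\theta_i,\sigma_{p,i})$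 (variance $\sigma_{p,i}$) and $Z_i\sim N(0,1)$ be independent, and set $$U_i(\tau)=c_i(\tau)+d_i(\tau)(X_i+\sqrt{\sigma_{p,i}}Z_i),\qquad V_i(\tau)=c_i(\tau)+d_i(\tau)(X_i-\sqrt{\sigma_{p,i}}Z_i),\qquad v_i(\tau)=2\sigma_{p,i}d_i(\tau)^2 .$$ Fix any $\gamma(i)$ with $0<\gamma(i)<1/\sqrt{4e}-\sqrt{\sigma_{p,i}/\sigma_{f,i}}$. For $n\ge1$ put $$\lambda_n(i)=\gamma(i)\sqrt{2\log n},\qquad K_n(i)=1+\Big\lceil e^2\big(\gamma(i)+\sqrt{2\sigma_{p,i}/\sigma_{f,i}}\big)^2\,2\log n\Big\rceil .$$ With $H_k$ the probabilists' Hermite polynomials and $G'$ the derivative of $G$ in its first argument, let $$S_i(u)=G(0,\tilde b_i)+G'(0,\tilde b_i)u+\phi(0)\sum_{k=0}^{K_n(i)-2}\frac{(-1)^kH_k(0)}{(k+2)!}\,v_i(\tau)^{(k+2)/2}H_{k+2}\!\Big(\frac{u}{\sqrt{v_i(\tau)}}\Big),$$ where at $v_i(\tau)=0$ (that is, $\tau=\infty$)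 the expression $v^{m/2}H_m(u/\sqrt v)$ is read as its limit $u^m$. Let $\tilde S_i(u)=\operatorname{sign}(S_i(u))\min\{|S_i(u)|,n\}$ and $$\hat T_i(X_i,Z_i,\tau)=\begin{cases}-\tilde b_iU_i(\tau)&\text{if }V_i(\tau)<-\lambda_n(i),\\ \tilde S_i(U_i(\tau))&\text{if }-\lambda_n(i)\le V_i(\tau)\le\lambda_n(i),\\ (1-\tilde b_i)U_i(\tau)&\text{if }V_i(\tau)>\lambda_n(i).\end{cases}$$ Write $\mathrm{Bias}_{\theta_i}(\hat T_i)=\mathbb E\,\hat T_i(X_i,Z_i,\tau)-G(c_i(\tau)+d_i(\tau)\theta_i,\tilde b_i)$ and $a_n=\log\log n$. Then for every coordinate $i$, the estimate $\hat T_i(X_i,Z_i,\tau)$ is square integrable for all $n,\tau,\theta_i$, and $$\lim_{n\to\infty}\ \sup_{\tau\in[0,\infty],\,\theta_i\in\mathbb R}a_n^8\,\big|\mathrm{Bias}_{\theta_i}(\hat T_i(X_i,Z_i,\tau))\big|=0,\qquad \lim_{n\to\infty}\ \sup_{\tau\in[0,\infty],\,\theta_i\in\mathbb R}n^{-1}a_n^8\,\mathrm{Var}_{\theta_i}(\hat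 T_i(X_i,Z_i,\tau))=0 .$$ -/

import Mathlib

open MeasureTheory ProbabilityTheory Filter Topology
open scoped ENNReal NNReal

noncomputable section

namespace CheckLoss

/-- Standard normal density `φ`. -/
def stdPDF (w : ℝ) : ℝ := gaussianPDFReal 0 1 w

/-- Standard normal distribution function `Φ`. -/
def stdCDF (w : ℝ) : ℝ := cdf (gaussianReal 0 1) w

/-- Standard normal quantile function `Φ⁻¹`. -/
def stdQuantile (p : ℝ) : ℝ := sInf {x : ℝ | p ≤ stdCDF x}

/-- `G(w, β) = φ(w) + w Φ(w) - β w`. -/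
def G (w β : ℝ) : ℝ := stdPDF w + w * stdCDF w - β * w

/-- `b̃ = b / (b + h)`. -/
def bTilde (b h : ℝ) : ℝ := b / (b + h)

/-- The shrinkage factor `α(τ) = τ / (τ + σp)` for `τ ∈ [0, ∞]`, with `α(∞) = 1`. -/
def shrink (σp : ℝ) (τ : ℝ≥0∞) : ℝ :=
  if τ = ⊤ then 1 else τ.toReal / (τ.toReal + σp)

/-- The intercept `c(τ)` of the coordinatewise risk. -/
def coefC (σp σf β : ℝ) (τ : ℝ≥0∞) : ℝ :=
  √((σf + shrink σp τ * σp) / (σf + shrink σp τ ^ 2 * σp)) * stdQuantile β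

/-- The slope `d(τ)` of the coordinatewise risk. -/
def coefD (σp σf : ℝ) (τ : ℝ≥0∞) : ℝ :=
  -((1 - shrink σp τ) / √(σf + σp * shrink σp τ ^ 2))

/-- Value of the `k`-th probabilists' Hermite polynomial at `x`. -/
def hermiteVal (k : ℕ) (x : ℝ) : ℝ := Polynomial.aeval x (Polynomial.hermite k)

/-- `v^{k/2} H_k(x / √v)` for a variance `v > 0`, extended to `v = 0` by its limit `x ^ k`
(the case `v = 0` occurs exactly at `τ = ∞`, where `d(τ) = 0`). -/
def scaledHermite (k : ℕ) (v x : ℝ) : ℝ :=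
  if v = 0 then x ^ k else √v ^ k * hermiteVal k (x / √v)

/-- The truncation order `K_n`. -/
def truncOrder (γ σp σf : ℝ) (n : ℕ) : ℕ :=
  1 + ⌈Real.exp 1 ^ 2 * (γ + √(2 * σp / σf)) ^ 2 * (2 * Real.log n)⌉₊

/-- The threshold `λ_n = γ √(2 log n)`. -/
def threshold (γ : ℝ) (n : ℕ) : ℝ := γ * √(2 * Real.log n)

/-- The estimate `S(u)`, for `u` drawn with variance `2 σp d(τ)²`; the sum is over
`k = 0, …, K_n - 2`. -/
def seriesEst (γ σp σf β : ℝ) (n : ℕ) (τ : ℝ≥0∞) (u : ℝ) : ℝ :=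
  G 0 β + deriv (fun w => G w β) 0 * u
    + stdPDF 0 * ∑ k ∈ Finset.range (truncOrder γ σp σf n - 1),
        (-1) ^ k * hermiteVal k 0 / ((k + 2).factorial : ℝ)
          * scaledHermite (k + 2) (2 * σp * coefD σp σf τ ^ 2) u

/-- The estimate `S̃(u)`: `S(u)` truncated at absolute value `n`. -/
def truncEst (γ σp σf β : ℝ) (n : ℕ) (τ : ℝ≥0∞) (u : ℝ) : ℝ :=
  Real.sign (seriesEst γ σp σf β n τ u) * min |seriesEst γ σp σf β n τ u| (n : ℝ)

/-- `U(τ) = c(τ) + d(τ) (x + √σp z)`. -/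
def splitU (σp σf β : ℝ) (τ : ℝ≥0∞) (x z : ℝ) : ℝ :=
  coefC σp σf β τ + coefD σp σf τ * (x + √σp * z)

/-- `V(τ) = c(τ) + d(τ) (x - √σp z)`. -/
def splitV (σp σf β : ℝ) (τ : ℝ≥0∞) (x z : ℝ) : ℝ :=
  coefC σp σf β τ + coefD σp σf τ * (x - √σp * z)

/-- The randomized threshold estimate `T̂(x, z, τ)` of one coordinate, in dimension `n`. -/
def thresholdEst (γ σp σf β : ℝ) (n : ℕ) (τ : ℝ≥0∞) (x z : ℝ) : ℝ :=
  if splitV σp σf β τ x z < -threshold γ n then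
    -(β * splitU σp σf β τ x z)
  else if splitV σp σf β τ x z ≤ threshold γ n then
    truncEst γ σp σf β n τ (splitU σp σf β τ x z)
  else
    (1 - β) * splitU σp σf β τ x z

/-- Joint law of `(X, Z)` in one coordinate: independent, `X ∼ N(θ, σp)` (variance `σp`) and
`Z ∼ N(0, 1)`. -/
def coordLaw (σp θ : ℝ) : Measure (ℝ × ℝ) :=
  (gaussianReal θ σp.toNNReal).prod (gaussianReal 0 1)

/-- The estimand `G(c(τ) + d(τ) θ, β)`. -/
def target (σp σf β : ℝ) (τ : ℝ≥0∞) (θ : ℝ) : ℝ :=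
  G (coefC σp σf β τ + coefD σp σf τ * θ) β

/-- Bias of `T̂(X, Z, τ)` as an estimate of `G(c(τ) + d(τ) θ, β)`. -/
def bias (γ σp σf β : ℝ) (n : ℕ) (τ : ℝ≥0∞) (θ : ℝ) : ℝ :=
  (∫ p, thresholdEst γ σp σf β n τ p.1 p.2 ∂(coordLaw σp θ)) - target σp σf β τ θ

/-- Variance of `T̂(X, Z, τ)`. -/
def estVar (γ σp σf β : ℝ) (n : ℕ) (τ : ℝ≥0∞) (θ : ℝ) : ℝ :=
  variance (fun p : ℝ × ℝ => thresholdEst γ σp σf β n τ p.1 p.2) (coordLaw σp θ)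

/-- `a_n = log log n`. -/
def rate (n : ℕ) : ℝ := Real.log (Real.log n)

/-- Bounded weights of the loss function: `0 < inf b̃_i`, `sup b̃_i < 1`, `sup (b_i + h_i) < ∞`. -/
def BoundedWeights (b h : ℕ → ℝ) : Prop :=
  (∃ lo > 0, ∀ i, lo ≤ bTilde (b i) (h i)) ∧
  (∃ hi < 1, ∀ i, bTilde (b i) (h i) ≤ hi) ∧
  (∃ M, ∀ i, b i + h i ≤ M)

/-- Sufficient historical data: `sup σp_i / σf_i < 1 / (4e)`, `sup σf_i < ∞`, `inf σp_i > 0`. -/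
def SufficientHistory (σp σf : ℕ → ℝ) : Prop :=
  (∃ r < 1 / (4 * Real.exp 1), ∀ i, σp i / σf i ≤ r) ∧
  (∃ M, ∀ i, σf i ≤ M) ∧
  (∃ m > 0, ∀ i, m ≤ σp i)

end CheckLoss

end

/-!
Fix a coordinate and write `μ = c(τ) + d(τ) θ`, `w = 2 σp / σf` and `y = √(2 log n)`, so that
`n = exp (y² / 2)` and `v(τ) ≤ w`. The variables `U` and `V` are jointly Gaussian and uncorrelated,
hence independent copies of `N(μ, v(τ))`: `V` decides on the branch and `U` estimates `G(μ, β)`.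

Outside the threshold the branches are unbiased for the check loss `μ⁺ - β μ`, which is within
`O(1 / |μ|)` of `G(μ, β)`; by Chebyshev's inequality, `V` rarely has the wrong sign there.

Inside the threshold, Hermite polynomials of variance `v` are unbiased for powers of the mean, so
`S(U)` is unbiased for a Taylor polynomial of `G(·, β)` at `0`, which is accurate as long as
`|μ| ≤ λ + √w y`. Its second moment grows like `exp (μ² / (1 - v))`, whereas `|V| ≤ λ` has
probability at most `exp (-(|μ| - λ)² / (2w))`. If `w < 1 / 3` the product is at most
`exp (λ² / (1 - 3w))`, and `λ = γ y` makes this a power of `n` with exponent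
`2 γ² / (1 - 3w) < 1`. All resulting errors are `O(1 / √(log n))` uniformly in `μ` and `v`, which
outweighs the factor `(log log n)⁸`.
-/

noncomputable section

namespace CheckLoss

section SplitGaussian

variable {Ω : Type*} {mΩ : MeasurableSpace Ω} {P : Measure Ω} {X Y : Ω → ℝ}

lemma indepFun_add_sub_of_variance_eq (hX : HasGaussianLaw X P) (hY : HasGaussianLaw Y P)
    (hXY : IndepFun X Y P) (hvar : Var[X; P] = Var[Y; P]) : IndepFun (X + Y) (X - Y) P := by
  have := hX.isProbabilityMeasure
  have hjoint : HasGaussianLaw (fun ω => ((X + Y) ω, (X - Y) ω)) P :=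
    (hXY.hasGaussianLaw hX hY).map_fun
      ((ContinuousLinearMap.fst ℝ ℝ ℝ + ContinuousLinearMap.snd ℝ ℝ ℝ).prod
        (ContinuousLinearMap.fst ℝ ℝ ℝ - ContinuousLinearMap.snd ℝ ℝ ℝ))
  refine hjoint.indepFun_of_covariance_eq_zero ?_
  have hX2 := hX.memLp_two
  have hY2 := hY.memLp_two
  rw [covariance_sub_right (hX2.add hY2) hX2 hY2, covariance_add_left hX2 hY2 hX2,
    covariance_add_left hX2 hY2 hY2, covariance_self hX.aemeasurable,
    covariance_self hY.aemeasurable, covariance_comm, hvar]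
  ring

lemma hasLaw_affine_add_sub {θ : ℝ} {v : ℝ≥0} (hX : HasLaw X (gaussianReal θ v) P)
    (hY : HasLaw Y (gaussianReal 0 v) P) (hXY : IndepFun X Y P) (c d : ℝ) :
    HasLaw (fun ω => (c + d * (X ω + Y ω), c + d * (X ω - Y ω)))
      ((gaussianReal (c + d * θ) (2 * v * d ^ 2).toNNReal).prod
        (gaussianReal (c + d * θ) (2 * v * d ^ 2).toNNReal)) P := by
  have := hX.isProbabilityMeasure
  have hind : IndepFun (X + Y) (X - Y) P :=
    indepFun_add_sub_of_variance_eq hX.hasGaussianLaw hY.hasGaussianLaw hXY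
      (by rw [hX.variance_eq, hY.variance_eq, variance_id_gaussianReal, variance_id_gaussianReal])
  have haffine {W : Ω → ℝ} (hW : HasLaw W (gaussianReal θ (v + v)) P) :
      HasLaw (fun ω => c + d * W ω)
        (gaussianReal (c + d * θ) (2 * v * d ^ 2).toNNReal) P := by
    convert gaussianReal_const_add (gaussianReal_const_mul hW d) c using 2
    · ring
    · refine NNReal.coe_injective ?_
      rw [Real.coe_toNNReal _ (by positivity)]
      push_cast
      ring
  have hadd : HasLaw (X + Y) (gaussianReal θ (v + v)) P := by
    simpa [gaussianReal_conv_gaussianReal] using hXY.hasLaw_add hX hY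
  have hsub : HasLaw (X - Y) (gaussianReal θ (v + v)) P := by
    have h := (hXY.comp measurable_id measurable_neg).hasLaw_add hX (gaussianReal_neg hY)
    simpa [gaussianReal_conv_gaussianReal, sub_eq_add_neg] using h
  have hmeas : Measurable fun x : ℝ => c + d * x := by fun_prop
  exact (hind.comp hmeas hmeas).hasLaw_prod (haffine hadd) (haffine hsub)

end SplitGaussian

lemma hasLaw_split_coordLaw {σp : ℝ} (hσp : 0 ≤ σp) (θ c d : ℝ) :
    HasLaw (fun p : ℝ × ℝ => (c + d * (p.1 + √σp * p.2), c + d * (p.1 - √σp * p.2)))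
      ((gaussianReal (c + d * θ) (2 * σp * d ^ 2).toNNReal).prod
        (gaussianReal (c + d * θ) (2 * σp * d ^ 2).toNNReal)) (coordLaw σp θ) := by
  have hfst : HasLaw Prod.fst (gaussianReal θ σp.toNNReal) (coordLaw σp θ) :=
    measurePreserving_fst.hasLaw
  have hsnd : HasLaw (fun p : ℝ × ℝ => √σp * p.2) (gaussianReal 0 σp.toNNReal)
      (coordLaw σp θ) := by
    have hlaw : HasLaw Prod.snd (gaussianReal 0 1) (coordLaw σp θ) := measurePreserving_snd.hasLaw
    convert gaussianReal_const_mul hlaw √σp using 2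
    · simp
    · ext
      simp [hσp]
  have hind : IndepFun Prod.fst (fun p : ℝ × ℝ => √σp * p.2) (coordLaw σp θ) :=
    indepFun_prod (X := fun x => x) (Y := fun z => √σp * z) measurable_id (by fun_prop)
  simpa [hσp] using hasLaw_affine_add_sub hfst hsnd hind c d

section HermitePolynomials

open Polynomial

/-- The Hermite polynomials `P_m` of variance `v`, given by `P_{m+1} = X P_m - v P_m'`. With this
recursion, unlike with `v ^ (m / 2) H_m(x / √v)`, the case `v = 0` is not exceptional. -/
def scaledHermitePoly (v : ℝ) : ℕ → ℝ[X]
  | 0 => 1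
  | m + 1 => X * scaledHermitePoly v m - C v * derivative (scaledHermitePoly v m)

lemma scaledHermitePoly_zero_left (m : ℕ) : scaledHermitePoly 0 m = X ^ m := by
  induction m with
  | zero => rw [scaledHermitePoly, pow_zero]
  | succ m ih => rw [scaledHermitePoly, ih, C_0, zero_mul, sub_zero, pow_succ']

lemma scaledHermitePoly_sq_eq_comp_hermite {s : ℝ} (hs : s ≠ 0) (m : ℕ) :
    scaledHermitePoly (s ^ 2) m =
      C (s ^ m) * ((hermite m).map (Int.castRingHom ℝ)).comp (C s⁻¹ * X) := by
  induction m with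
  | zero => simp [scaledHermitePoly]
  | succ m ih =>
    have hinv : C s * C s⁻¹ = (1 : ℝ[X]) := by rw [← C_mul, mul_inv_cancel₀ hs, C_1]
    rw [scaledHermitePoly, ih, hermite_succ, Polynomial.map_sub, Polynomial.map_mul, sub_comp,
      mul_comp, derivative_mul, derivative_C, derivative_comp, map_X, X_comp, derivative_map]
    simp only [derivative_mul, derivative_C, derivative_X, C_mul, C_pow, C_1, pow_succ,
      pow_zero]
    set p := ((hermite m).map (Int.castRingHom ℝ)).comp (C s⁻¹ * X)
    set q := ((derivative (hermite m)).map (Int.castRingHom ℝ)).comp (C s⁻¹ * X)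
    linear_combination (-(C s ^ m * p * X) - C s ^ m * q * C s) * hinv

lemma scaledHermite_eq_eval {v : ℝ} (hv : 0 ≤ v) (m : ℕ) (x : ℝ) :
    scaledHermite m v x = (scaledHermitePoly v m).eval x := by
  unfold scaledHermite
  split_ifs with hv0
  · rw [hv0, scaledHermitePoly_zero_left, eval_pow, eval_X]
  · have hs : √v ≠ 0 := Real.sqrt_ne_zero'.2 (hv.lt_of_ne' hv0)
    conv_rhs => rw [← Real.sq_sqrt hv, scaledHermitePoly_sq_eq_comp_hermite hs]
    rw [hermiteVal, aeval_def, ← eval_map, div_eq_inv_mul, eval_mul, eval_comp, eval_C, eval_mul,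
      eval_C, eval_X]
    rfl

lemma derivative_scaledHermitePoly_succ (v : ℝ) (m : ℕ) :
    derivative (scaledHermitePoly v (m + 1)) = C ((m : ℝ) + 1) * scaledHermitePoly v m := by
  induction m with
  | zero => simp [scaledHermitePoly]
  | succ m ih =>
    rw [scaledHermitePoly, derivative_sub, derivative_mul, derivative_X, derivative_mul,
      derivative_C, ih, derivative_mul, derivative_C]
    conv_lhs => rw [scaledHermitePoly]
    conv_rhs => rw [scaledHermitePoly]
    simp only [Nat.cast_add, Nat.cast_one, C_add, C_1]
    ring

lemma iterate_derivative_scaledHermitePoly (v : ℝ) {m j : ℕ} (hj : j ≤ m) :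
    derivative^[j] (scaledHermitePoly v m) =
      C (m.descFactorial j : ℝ) * scaledHermitePoly v (m - j) := by
  induction j with
  | zero => simp
  | succ j ih =>
    have hsub : m - j = m - (j + 1) + 1 := by omega
    rw [Function.iterate_succ_apply', ih (by omega), hsub, derivative_C_mul,
      derivative_scaledHermitePoly_succ, ← mul_assoc, ← C_mul, Nat.descFactorial_succ, hsub]
    push_cast
    ring_nf

end HermitePolynomials

section GaussianIntegrals

open Polynomial

variable (μ : ℝ) (v : ℝ≥0)

lemma integrable_eval_gaussianReal (p : ℝ[X]) :
    Integrable (fun x => p.eval x) (gaussianReal μ v) := by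
  induction p using Polynomial.induction_on' with
  | add p q hp hq => simpa only [eval_add] using hp.fun_add hq
  | monomial n a =>
    simp only [eval_monomial]
    refine Integrable.const_mul ((integrable_norm_iff (by fun_prop)).1 ?_) a
    simpa using (memLp_id_gaussianReal' (μ := μ) (v := v) n (by simp)).integrable_norm_pow'

lemma memLp_two_eval_gaussianReal (p : ℝ[X]) :
    MemLp (fun x => p.eval x) 2 (gaussianReal μ v) := by
  refine (memLp_two_iff_integrable_sq (by fun_prop)).2 ?_
  simpa only [← eval_pow] using integrable_eval_gaussianReal μ v (p ^ 2)

variable {v} in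
lemma hasDerivAt_gaussianPDFReal (hv : v ≠ 0) (x : ℝ) :
    HasDerivAt (gaussianPDFReal μ v) (-((x - μ) / v) * gaussianPDFReal μ v x) x := by
  have hv' : (v : ℝ) ≠ 0 := NNReal.coe_ne_zero.2 hv
  have hexponent : HasDerivAt (fun x : ℝ => -(x - μ) ^ 2 / (2 * v)) (-((x - μ) / v)) x := by
    refine ((((hasDerivAt_id x).sub_const μ).pow 2).neg.div_const (2 * (v : ℝ))).congr_deriv ?_
    simp only [id_eq]
    push_cast
    field_simp
  refine (hexponent.exp.const_mul (√(2 * Real.pi * v))⁻¹).congr_deriv ?_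
  rw [gaussianPDFReal]
  ring

variable {v} in
lemma integrable_gaussianPDFReal_mul_eval (hv : v ≠ 0) (p : ℝ[X]) :
    Integrable (fun x => gaussianPDFReal μ v x * p.eval x) := by
  have h := integrable_eval_gaussianReal μ v p
  rw [gaussianReal_of_var_ne_zero _ hv,
    integrable_withDensity_iff_integrable_smul' (measurable_gaussianPDF _ _)
      (ae_of_all _ fun _ => gaussianPDF_lt_top)] at h
  simp only [toReal_gaussianPDF, smul_eq_mul] at h
  exact h

lemma integral_sub_mul_eval_gaussianReal (p : ℝ[X]) :
    ∫ x, (x - μ) * p.eval x ∂gaussianReal μ v =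
      v * ∫ x, (derivative p).eval x ∂gaussianReal μ v := by
  rcases eq_or_ne v 0 with rfl | hv
  · simp [gaussianReal_zero_var]
  have hv' : (v : ℝ) ≠ 0 := NNReal.coe_ne_zero.2 hv
  have hint := integrable_gaussianPDFReal_mul_eval μ hv
  have hparts := integral_mul_deriv_eq_deriv_mul_of_integrable
    (u := fun x => p.eval x) (v := gaussianPDFReal μ v)
    (u' := fun x => (derivative p).eval x)
    (v' := fun x => -((x - μ) / v) * gaussianPDFReal μ v x)
    (fun x _ => p.hasDerivAt x) (fun x _ => hasDerivAt_gaussianPDFReal μ hv x)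
    (((hint ((X - C μ) * p)).const_mul (-(v : ℝ)⁻¹)).congr
      (ae_of_all _ fun x => by
        simp only [Pi.mul_apply, eval_mul, eval_sub, eval_X, eval_C]; field))
    ((hint (derivative p)).congr (ae_of_all _ fun x => mul_comm _ _))
    ((hint p).congr (ae_of_all _ fun x => mul_comm _ _))
  rw [integral_gaussianReal_eq_integral_smul hv, integral_gaussianReal_eq_integral_smul hv]
  calc ∫ x, gaussianPDFReal μ v x • ((x - μ) * p.eval x)
      = -v * ∫ x, p.eval x * (-((x - μ) / v) * gaussianPDFReal μ v x) := by
        rw [← integral_const_mul]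
        congr! 2
        rw [smul_eq_mul]
        field
    _ = v * ∫ x, gaussianPDFReal μ v x • (derivative p).eval x := by
        rw [hparts, neg_mul_neg]
        simp only [smul_eq_mul, mul_comm]

lemma integral_scaledHermitePoly_succ_mul (m : ℕ) (f : ℝ[X]) :
    ∫ x, (scaledHermitePoly v (m + 1) * f).eval x ∂gaussianReal μ v =
      ∫ x, (scaledHermitePoly v m * (C μ * f + C (v : ℝ) * derivative f)).eval x
        ∂gaussianReal μ v := by
  have hint := integrable_eval_gaussianReal μ v
  let q := (X - C μ) * (scaledHermitePoly v m * f) -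
    C (v : ℝ) * derivative (scaledHermitePoly v m * f)
  have hsplit : scaledHermitePoly v (m + 1) * f =
      scaledHermitePoly v m * (C μ * f + C (v : ℝ) * derivative f) + q := by
    simp only [scaledHermitePoly, q, derivative_mul]
    ring
  have hstein : ∫ x, q.eval x ∂gaussianReal μ v = 0 := by
    simp only [q, eval_sub (p := _ * _)]
    rw [integral_sub (hint _) (hint _), sub_eq_zero]
    simpa only [eval_mul, eval_sub, eval_X, eval_C, integral_const_mul] using
      integral_sub_mul_eval_gaussianReal μ v (scaledHermitePoly v m * f)
  simp only [hsplit, eval_add (p := _ * _)]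
  rw [integral_add (hint _) (hint _), hstein, add_zero]

lemma integral_scaledHermitePoly (m : ℕ) :
    ∫ x, (scaledHermitePoly v m).eval x ∂gaussianReal μ v = μ ^ m := by
  induction m with
  | zero => simp [scaledHermitePoly]
  | succ m ih =>
    have h := integral_scaledHermitePoly_succ_mul μ v m 1
    simp only [mul_one, derivative_one, mul_zero, add_zero, eval_mul, eval_C,
      integral_mul_const] at h
    rw [h, ih, pow_succ]

/-- The operator `μ + v D` on polynomials, whose powers are the adjoints of multiplication by the
Hermite polynomials of variance `v` in the expectation under `N(μ, v)`. -/
def shiftOp (μ v : ℝ) : Module.End ℝ ℝ[X] :=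
  v • (derivative : ℝ[X] →ₗ[ℝ] ℝ[X]) + algebraMap ℝ (Module.End ℝ ℝ[X]) μ

lemma shiftOp_apply (μ v : ℝ) (f : ℝ[X]) :
    shiftOp μ v f = C μ * f + C v * derivative f := by
  simp [shiftOp, smul_eq_C_mul, add_comm]

lemma shiftOp_pow_apply (μ v : ℝ) (m : ℕ) (f : ℝ[X]) :
    (shiftOp μ v ^ m) f =
      ∑ j ∈ Finset.range (m + 1),
        C (v ^ j * μ ^ (m - j) * m.choose j) * derivative^[j] f := by
  have hcomm : Commute (v • (derivative : ℝ[X] →ₗ[ℝ] ℝ[X]))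
      (algebraMap ℝ (Module.End ℝ ℝ[X]) μ) := (Algebra.commutes μ _).symm
  rw [shiftOp, hcomm.add_pow, LinearMap.sum_apply]
  refine Finset.sum_congr rfl fun j _ => ?_
  rw [← map_pow, ← map_natCast (algebraMap ℝ (Module.End ℝ ℝ[X])), mul_assoc, ← map_mul,
    Module.End.mul_apply, Module.algebraMap_end_apply, map_smul, _root_.smul_pow,
    LinearMap.smul_apply, Module.End.pow_apply, smul_smul, smul_eq_C_mul]
  ring_nf

lemma integral_scaledHermitePoly_mul (m : ℕ) (f : ℝ[X]) :
    ∫ x, (scaledHermitePoly v m * f).eval x ∂gaussianReal μ v =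
      ∫ x, ((shiftOp μ v ^ m) f).eval x ∂gaussianReal μ v := by
  induction m generalizing f with
  | zero => simp [scaledHermitePoly]
  | succ m ih =>
    rw [integral_scaledHermitePoly_succ_mul, ← shiftOp_apply, ih, pow_succ, Module.End.mul_apply]

lemma integral_scaledHermitePoly_sq (m : ℕ) :
    ∫ x, (scaledHermitePoly v m).eval x ^ 2 ∂gaussianReal μ v =
      ∑ j ∈ Finset.range (m + 1),
        (m.choose j : ℝ) * (v : ℝ) ^ j * (m.descFactorial j : ℝ) * (μ ^ 2) ^ (m - j) := by
  have h := integral_scaledHermitePoly_mul μ v m (scaledHermitePoly v m)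
  simp only [← sq, eval_pow] at h
  simp only [h, shiftOp_pow_apply, eval_finsetSum]
  rw [integral_finsetSum _ fun j _ => integrable_eval_gaussianReal μ v _]
  refine Finset.sum_congr rfl fun j hj => ?_
  rw [iterate_derivative_scaledHermitePoly v (Finset.mem_range_succ_iff.1 hj)]
  simp only [eval_mul, eval_C, integral_const_mul, integral_scaledHermitePoly]
  ring

lemma choose_mul_pow_le {v : ℝ} (hv : 0 ≤ v) (hv1 : v < 1) {m j : ℕ} (hj : j ≤ m) :
    m.choose j * v ^ j ≤ (1 - v)⁻¹ ^ (m - j) := by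
  have : 0 < 1 - v := sub_pos.2 hv1
  have hterm := Finset.single_le_sum (f := fun j => v ^ j * (1 - v) ^ (m - j) * (m.choose j : ℝ))
    (fun i _ => by positivity) (Finset.mem_range_succ_iff.2 hj)
  rw [← add_pow, add_sub_cancel, one_pow] at hterm
  rw [inv_pow, ← one_div, le_div_iff₀ (by positivity)]
  linarith

lemma integral_scaledHermitePoly_sq_le {v : ℝ≥0} (hv : v < 1) (m : ℕ) :
    ∫ x, (scaledHermitePoly v m).eval x ^ 2 ∂gaussianReal μ v ≤
      (m.factorial : ℝ) * Real.exp (μ ^ 2 / (1 - v)) := by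
  have hv' : (v : ℝ) < 1 := by exact_mod_cast hv
  have : 0 < 1 - (v : ℝ) := sub_pos.2 hv'
  rw [integral_scaledHermitePoly_sq]
  calc _ ≤ ∑ j ∈ Finset.range (m + 1),
        (m.factorial : ℝ) * ((μ ^ 2 / (1 - v)) ^ (m - j) / (m - j).factorial) := by
        refine Finset.sum_le_sum fun j hj => ?_
        have hjm : j ≤ m := Finset.mem_range_succ_iff.1 hj
        have hdesc : (m.descFactorial j : ℝ) = m.factorial / (m - j).factorial := by
          rw [eq_div_iff (by positivity), mul_comm]
          exact_mod_cast Nat.factorial_mul_descFactorial hjm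
        calc _ ≤ (1 - (v : ℝ))⁻¹ ^ (m - j) * (m.descFactorial j : ℝ) * (μ ^ 2) ^ (m - j) := by
              gcongr
              exact choose_mul_pow_le v.2 hv' hjm
          _ = _ := by
              rw [hdesc, div_eq_mul_inv (μ ^ 2), mul_pow]
              ring
    _ = (m.factorial : ℝ) *
        ∑ j ∈ Finset.range (m + 1), (μ ^ 2 / (1 - v)) ^ j / (j.factorial : ℝ) := by
        rw [← Finset.mul_sum, Finset.sum_flip fun k => (μ ^ 2 / (1 - (v : ℝ))) ^ k / k.factorial]
    _ ≤ _ := by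
        gcongr
        exact Real.sum_le_exp_of_nonneg (by positivity) _

end GaussianIntegrals

section HermiteSum

open Polynomial

/-- The polynomial `∑_{k < N} c_k P_k` in the Hermite polynomials of variance `v`, which under
`N(μ, v)` is an unbiased estimate of `∑_{k < N} c_k μ ^ k`. -/
def hermiteSum (c : ℕ → ℝ) (v : ℝ) (N : ℕ) : ℝ[X] :=
  ∑ k ∈ Finset.range N, C (c k) * scaledHermitePoly v k

lemma integral_hermiteSum (c : ℕ → ℝ) (μ : ℝ) (v : ℝ≥0) (N : ℕ) :
    ∫ x, (hermiteSum c v N).eval x ∂gaussianReal μ v = ∑ k ∈ Finset.range N, c k * μ ^ k := by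
  simp only [hermiteSum, eval_finsetSum]
  rw [integral_finsetSum _ fun k _ => integrable_eval_gaussianReal μ v _]
  simp only [eval_mul, eval_C, integral_const_mul, integral_scaledHermitePoly]

lemma integral_hermiteSum_sq_le {c : ℕ → ℝ} (hc : ∀ k, c k ^ 2 * k.factorial ≤ 1) (μ : ℝ)
    {v : ℝ≥0} (hv : v < 1) (N : ℕ) :
    ∫ x, (hermiteSum c v N).eval x ^ 2 ∂gaussianReal μ v ≤
      (N : ℝ) ^ 2 * Real.exp (μ ^ 2 / (1 - v)) := by
  have hint (p : ℝ[X]) : Integrable (fun x => p.eval x ^ 2) (gaussianReal μ v) :=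
    (memLp_two_eval_gaussianReal μ v p).integrable_sq
  calc ∫ x, (hermiteSum c v N).eval x ^ 2 ∂gaussianReal μ v
      ≤ ∫ x, N * ∑ k ∈ Finset.range N, (C (c k) * scaledHermitePoly v k).eval x ^ 2
          ∂gaussianReal μ v := by
        refine integral_mono (hint _)
          ((integrable_finsetSum _ fun k _ => hint _).const_mul _) fun x => ?_
        simpa only [hermiteSum, eval_finsetSum, Finset.card_range] using
          sq_sum_le_card_mul_sum_sq (s := Finset.range N)
            (f := fun k => (C (c k) * scaledHermitePoly v k).eval x)
    _ = N * ∑ k ∈ Finset.range N,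
          c k ^ 2 * ∫ x, (scaledHermitePoly v k).eval x ^ 2 ∂gaussianReal μ v := by
        rw [integral_const_mul, integral_finsetSum _ fun k _ => hint _]
        simp only [eval_mul, eval_C, mul_pow, integral_const_mul]
    _ ≤ N * ∑ k ∈ Finset.range N, Real.exp (μ ^ 2 / (1 - v)) := by
        gcongr with k
        calc _ ≤ c k ^ 2 * (k.factorial * Real.exp (μ ^ 2 / (1 - v))) := by
              gcongr
              exact integral_scaledHermitePoly_sq_le μ hv k
          _ ≤ Real.exp (μ ^ 2 / (1 - v)) := by
              rw [← mul_assoc]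
              exact mul_le_of_le_one_left (Real.exp_pos _).le (hc k)
    _ = _ := by
        rw [Finset.sum_const, Finset.card_range, nsmul_eq_mul]
        ring

lemma hermiteVal_eq_eval (k : ℕ) (x : ℝ) : hermiteVal k x = (scaledHermitePoly 1 k).eval x := by
  rw [← scaledHermite_eq_eval zero_le_one, scaledHermite, if_neg one_ne_zero, Real.sqrt_one,
    one_pow, one_mul, div_one]

lemma hermiteVal_add_two_zero (k : ℕ) : hermiteVal (k + 2) 0 = -((k + 1) * hermiteVal k 0) := by
  rw [hermiteVal_eq_eval, hermiteVal_eq_eval, scaledHermitePoly, derivative_scaledHermitePoly_succ]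
  simp only [C_1, one_mul, eval_sub, eval_mul, eval_X, zero_mul, eval_C, zero_sub]

lemma hermiteVal_zero_sq_le (k : ℕ) : hermiteVal k 0 ^ 2 ≤ k.factorial := by
  induction k using Nat.twoStepInduction with
  | zero => simp [hermiteVal]
  | one => simp [hermiteVal]
  | more k ih _ =>
    rw [hermiteVal_add_two_zero, neg_sq, mul_pow]
    calc ((k : ℝ) + 1) ^ 2 * hermiteVal k 0 ^ 2 ≤ ((k + 2) * (k + 1)) * k.factorial := by
          gcongr
          nlinarith
      _ = (k + 2).factorial := by
          rw [Nat.factorial_succ, Nat.factorial_succ]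
          push_cast
          ring

lemma hermiteVal_two_mul_add_one_zero (j : ℕ) : hermiteVal (2 * j + 1) 0 = 0 := by
  induction j with
  | zero => simp [hermiteVal]
  | succ j ih => rw [show 2 * (j + 1) + 1 = 2 * j + 1 + 2 by ring, hermiteVal_add_two_zero, ih,
      mul_zero, neg_zero]

lemma hermiteVal_two_mul_zero_div_factorial (j : ℕ) :
    hermiteVal (2 * j) 0 / (2 * j).factorial = (-1 / 2) ^ j / j.factorial := by
  induction j with
  | zero => simp [hermiteVal]
  | succ j ih =>
    have hval : hermiteVal (2 * j) 0 = (-1 / 2) ^ j / j.factorial * (2 * j).factorial := by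
      rw [← ih, div_mul_cancel₀ _ (by positivity)]
    rw [show 2 * (j + 1) = 2 * j + 2 by ring, hermiteVal_add_two_zero, hval, Nat.factorial_succ,
      Nat.factorial_succ, Nat.factorial_succ]
    push_cast
    field_simp
    ring

lemma sum_hermiteVal_zero_mul_pow (M : ℕ) (w : ℝ) :
    ∑ k ∈ Finset.range M, (-1) ^ k * hermiteVal k 0 / k.factorial * w ^ k =
      ∑ j ∈ Finset.range ((M + 1) / 2), (-(w ^ 2 / 2)) ^ j / j.factorial := by
  induction M with
  | zero => simp
  | succ M ih =>
    rw [Finset.sum_range_succ, ih]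
    rcases Nat.even_or_odd' M with ⟨j, rfl | rfl⟩
    · rw [show (2 * j + 1) / 2 = j by omega, show (2 * j + 1 + 1) / 2 = j + 1 by omega,
        Finset.sum_range_succ, mul_div_assoc, hermiteVal_two_mul_zero_div_factorial,
        show -(w ^ 2 / 2) = -1 / 2 * w ^ 2 by ring, mul_pow, pow_mul, pow_mul w, neg_one_sq,
        one_pow]
      ring
    · rw [show (2 * j + 1 + 1) / 2 = j + 1 by omega,
        show (2 * j + 1 + 1 + 1) / 2 = j + 1 by omega, hermiteVal_two_mul_add_one_zero, mul_zero,
        zero_div, zero_mul, add_zero]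

end HermiteSum

section StandardNormal

lemma stdPDF_eq_mul_exp (w : ℝ) : stdPDF w = stdPDF 0 * Real.exp (-(w ^ 2 / 2)) := by
  simp [stdPDF, gaussianPDFReal, neg_div]

lemma stdPDF_nonneg (w : ℝ) : 0 ≤ stdPDF w := gaussianPDFReal_nonneg 0 1 w

lemma stdPDF_zero_le_one : stdPDF 0 ≤ 1 := by
  have hsqrt : 1 ≤ √(2 * Real.pi) := Real.one_le_sqrt.2 (by linarith [Real.pi_gt_three])
  simpa [stdPDF, gaussianPDFReal] using inv_le_one_of_one_le₀ hsqrt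

lemma hasDerivAt_stdPDF (w : ℝ) : HasDerivAt stdPDF (-(w * stdPDF w)) w := by
  refine (hasDerivAt_gaussianPDFReal 0 one_ne_zero w).congr_deriv ?_
  rw [sub_zero, NNReal.coe_one, div_one, neg_mul, stdPDF]

lemma stdCDF_eq_integral (w : ℝ) : stdCDF w = ∫ t in Set.Iic w, stdPDF t := by
  rw [stdCDF, cdf_eq_real, measureReal_def, gaussianReal_apply_eq_integral 0 one_ne_zero,
    ENNReal.toReal_ofReal (integral_nonneg fun _ => gaussianPDFReal_nonneg 0 1 _)]
  rfl

lemma hasDerivAt_stdCDF (w : ℝ) : HasDerivAt stdCDF (stdPDF w) w := by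
  have hint : Integrable stdPDF := integrable_gaussianPDFReal 0 1
  have hcont : Continuous stdPDF :=
    continuous_iff_continuousAt.2 fun x => (hasDerivAt_stdPDF x).continuousAt
  have hsplit : stdCDF = fun x => stdCDF 0 + ∫ t in (0 : ℝ)..x, stdPDF t := by
    ext x
    rw [stdCDF_eq_integral, stdCDF_eq_integral,
      ← intervalIntegral.integral_Iic_sub_Iic hint.integrableOn hint.integrableOn,
      add_sub_cancel]
  rw [hsplit]
  exact (hcont.integral_hasStrictDerivAt 0 w).hasDerivAt.const_add _

lemma stdCDF_nonneg (w : ℝ) : 0 ≤ stdCDF w := cdf_nonneg _ w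

lemma stdCDF_le_one (w : ℝ) : stdCDF w ≤ 1 := cdf_le_one _ w

lemma hasDerivAt_G (β w : ℝ) : HasDerivAt (fun w => G w β) (stdCDF w - β) w := by
  refine (((hasDerivAt_stdPDF w).add ((hasDerivAt_id w).mul (hasDerivAt_stdCDF w))).sub
    ((hasDerivAt_id w).const_mul β)).congr_deriv ?_
  simp

end StandardNormal

section TaylorExpansion

/-- The Taylor coefficients of `G(·, β)` at `0`. -/
def taylorCoef (β : ℝ) : ℕ → ℝ
  | 0 => G 0 β
  | 1 => stdCDF 0 - β
  | k + 2 => stdPDF 0 * ((-1) ^ k * hermiteVal k 0 / (k + 2).factorial)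

lemma taylorCoef_sq_mul_factorial_le {β : ℝ} (hβ : β ∈ Set.Icc 0 1) (k : ℕ) :
    taylorCoef β k ^ 2 * k.factorial ≤ 1 := by
  have hφ : stdPDF 0 ^ 2 ≤ 1 := pow_le_one₀ (stdPDF_nonneg 0) stdPDF_zero_le_one
  match k with
  | 0 => simpa [taylorCoef, G] using hφ
  | 1 =>
    rw [taylorCoef, Nat.factorial_one, Nat.cast_one, mul_one, sq_le_one_iff_abs_le_one, abs_le]
    constructor <;> linarith [stdCDF_nonneg 0, stdCDF_le_one 0, hβ.1, hβ.2]
  | k + 2 =>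
    have hfact : (0 : ℝ) < (k + 2).factorial := by positivity
    have hH : hermiteVal k 0 ^ 2 / (k + 2).factorial ≤ 1 := by
      refine (div_le_one hfact).2 ((hermiteVal_zero_sq_le k).trans ?_)
      exact_mod_cast Nat.factorial_le (Nat.le_add_right k 2)
    calc _ = stdPDF 0 ^ 2 * (hermiteVal k 0 ^ 2 / (k + 2).factorial) := by
          rw [taylorCoef, mul_pow, div_pow, mul_pow, ← pow_mul, mul_comm k, pow_mul, neg_one_sq,
            one_pow]
          field_simp
      _ ≤ 1 := mul_le_one₀ hφ (by positivity) hH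

lemma abs_exp_sub_sum_le {z : ℝ} {N : ℕ} (hN : Real.exp 2 * |z| ≤ N) :
    |Real.exp z - ∑ j ∈ Finset.range N, z ^ j / j.factorial| ≤ 2 * Real.exp (-N) := by
  have hhalf : |z| / N.succ ≤ 1 / 2 := by
    rw [div_le_iff₀ (by positivity)]
    push_cast
    nlinarith [Real.add_one_le_exp 2, abs_nonneg z]
  have hterm : (Real.exp 2 * |z|) ^ N / N.factorial ≤ Real.exp N :=
    (Real.pow_div_factorial_le_exp _ (by positivity) N).trans (Real.exp_le_exp.2 hN)
  have hremainder : |Real.exp z - ∑ j ∈ Finset.range N, z ^ j / j.factorial| ≤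
      |z| ^ N / N.factorial * 2 := by
    have h := Complex.exp_bound' (x := z) (n := N) (by simpa using hhalf)
    rw [Complex.norm_real, Real.norm_eq_abs] at h
    exact_mod_cast h
  calc _ ≤ |z| ^ N / N.factorial * 2 := hremainder
    _ = 2 * ((Real.exp 2 * |z|) ^ N / N.factorial * Real.exp (-(N * 2))) := by
        rw [mul_pow, ← Real.exp_nat_mul, Real.exp_neg]
        field_simp
    _ ≤ 2 * (Real.exp N * Real.exp (-(N * 2))) := by gcongr
    _ = _ := by
        rw [← Real.exp_add]
        ring_nf

lemma hasDerivAt_sum_mul_pow (c : ℕ → ℝ) (N : ℕ) (x : ℝ) :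
    HasDerivAt (fun x => ∑ k ∈ Finset.range (N + 1), c k * x ^ k)
      (∑ k ∈ Finset.range N, (k + 1) * c (k + 1) * x ^ k) x := by
  refine (HasDerivAt.fun_sum fun k _ => (hasDerivAt_pow k x).const_mul (c k)).congr_deriv ?_
  rw [Finset.sum_range_succ']
  simp only [Nat.cast_zero, zero_mul, mul_zero, add_zero, Nat.cast_add, Nat.cast_one,
    Nat.add_sub_cancel]
  exact Finset.sum_congr rfl fun k _ => by ring

lemma abs_le_mul_sq_of_hasDerivAt {f f' f'' : ℝ → ℝ} {ε x : ℝ}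
    (hf : ∀ t, HasDerivAt f (f' t) t) (hf' : ∀ t, HasDerivAt f' (f'' t) t) (hf0 : f 0 = 0)
    (hf'0 : f' 0 = 0) (hε : ∀ t, |t| ≤ |x| → |f'' t| ≤ ε) : |f x| ≤ ε * x ^ 2 := by
  have hε0 : 0 ≤ ε := (abs_nonneg _).trans (hε x le_rfl)
  have hmem {t : ℝ} : t ∈ Metric.closedBall 0 |x| ↔ |t| ≤ |x| := mem_closedBall_zero_iff
  have hzero : (0 : ℝ) ∈ Metric.closedBall 0 |x| := hmem.2 (by simp)
  have hball := convex_closedBall (0 : ℝ) |x|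
  have hbound : ∀ t ∈ Metric.closedBall 0 |x|, ‖f' t‖ ≤ ε * |x| := fun t ht => by
    have h := hball.norm_image_sub_le_of_norm_hasDerivWithin_le
      (fun s _ => (hf' s).hasDerivWithinAt) (fun s hs => hε s (hmem.1 hs)) hzero ht
    rw [hf'0, sub_zero, sub_zero] at h
    exact h.trans (mul_le_mul_of_nonneg_left (hmem.1 ht) hε0)
  have h := hball.norm_image_sub_le_of_norm_hasDerivWithin_le
    (fun s _ => (hf s).hasDerivWithinAt) hbound hzero (hmem.2 le_rfl)
  rwa [hf0, sub_zero, sub_zero, Real.norm_eq_abs, Real.norm_eq_abs, mul_assoc, abs_mul_abs_self,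
    ← sq] at h

lemma abs_sum_hermiteVal_sub_stdPDF_le {w : ℝ} {M : ℕ} (hM : Real.exp 2 * w ^ 2 ≤ M) :
    |stdPDF 0 * ∑ k ∈ Finset.range M, (-1) ^ k * hermiteVal k 0 / k.factorial * w ^ k - stdPDF w|
      ≤ 2 * Real.exp (-(M / 2)) := by
  have hhalf : (M : ℝ) / 2 ≤ ((M + 1) / 2 : ℕ) := by
    have : (M : ℝ) ≤ 2 * ((M + 1) / 2 : ℕ) := by exact_mod_cast (by omega)
    linarith
  have hexp : Real.exp 2 * |-(w ^ 2 / 2)| ≤ ((M + 1) / 2 : ℕ) := by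
    rw [abs_neg, abs_of_nonneg (by positivity)]
    linarith
  rw [sum_hermiteVal_zero_mul_pow, stdPDF_eq_mul_exp w, ← mul_sub, abs_mul,
    abs_of_nonneg (stdPDF_nonneg 0), abs_sub_comm]
  calc _ ≤ _ := mul_le_of_le_one_left (abs_nonneg _) stdPDF_zero_le_one
    _ ≤ _ := abs_exp_sub_sum_le hexp
    _ ≤ _ := by gcongr

lemma abs_sum_taylorCoef_sub_G_le (β : ℝ) {μ : ℝ} {M : ℕ} (hM : Real.exp 2 * μ ^ 2 ≤ M) :
    |∑ k ∈ Finset.range (M + 2), taylorCoef β k * μ ^ k - G μ β| ≤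
      2 * Real.exp (-(M / 2)) * μ ^ 2 := by
  refine abs_le_mul_sq_of_hasDerivAt (x := μ)
    (fun w => (hasDerivAt_sum_mul_pow (taylorCoef β) (M + 1) w).sub (hasDerivAt_G β w))
    (fun w => (hasDerivAt_sum_mul_pow (fun k => (k + 1) * taylorCoef β (k + 1)) M w).sub
      ((hasDerivAt_stdCDF w).sub_const β)) ?_ ?_ fun w hw => ?_
  · simp [Finset.sum_range_succ', taylorCoef]
  · simp [Finset.sum_range_succ', taylorCoef]
  · have hcoef (k : ℕ) : (k + 1) * (((k + 1 : ℕ) + 1) * taylorCoef β (k + 2)) =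
        stdPDF 0 * ((-1) ^ k * hermiteVal k 0 / k.factorial) := by
      rw [taylorCoef, Nat.factorial_succ, Nat.factorial_succ]
      push_cast
      field
    have hw2 : Real.exp 2 * w ^ 2 ≤ M :=
      le_trans (mul_le_mul_of_nonneg_left (sq_le_sq.2 hw) (Real.exp_pos 2).le) hM
    simp only [hcoef, mul_assoc, ← Finset.mul_sum]
    simpa only [mul_assoc] using abs_sum_hermiteVal_sub_stdPDF_le hw2

end TaylorExpansion

section GaussianProbabilities

variable (μ : ℝ) (v : ℝ≥0)

lemma integral_affine_sq_gaussianReal (a b : ℝ) :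
    ∫ x, (a * x + b) ^ 2 ∂gaussianReal μ v = a ^ 2 * v + (a * μ + b) ^ 2 := by
  have hid : MemLp (fun x : ℝ => x) 2 (gaussianReal μ v) := by
    simpa using memLp_two_eval_gaussianReal μ v Polynomial.X
  have hint : Integrable (fun x => a * x) (gaussianReal μ v) :=
    (hid.integrable one_le_two).const_mul a
  have hvar := variance_eq_sub ((hid.const_mul a).add (memLp_const b))
  simp only [Pi.add_def, Pi.pow_apply] at hvar
  rw [variance_add_const hint.aestronglyMeasurable, variance_const_mul,
    variance_fun_id_gaussianReal, integral_add hint (integrable_const b), integral_const_mul,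
    integral_id_gaussianReal, integral_const, probReal_univ, one_smul] at hvar
  linarith

/-- Chebyshev's inequality, without a division so that `t = 0` needs no exception. -/
lemma gaussianReal_real_mul_sq_le {s : Set ℝ} {t : ℝ} (ht : 0 ≤ t)
    (hs : ∀ x ∈ s, t ≤ |x - μ|) : (gaussianReal μ v).real s * t ^ 2 ≤ v := by
  have hint : Integrable (fun x => (1 * x + -μ) ^ 2) (gaussianReal μ v) := by
    have hsq := (memLp_two_eval_gaussianReal μ v
      (1 * Polynomial.X + Polynomial.C (-μ))).integrable_sq
    simpa using hsq
  have hsub : s ⊆ {x | t ^ 2 ≤ (1 * x + -μ) ^ 2} := fun x hx => by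
    rw [Set.mem_ofPred_eq, one_mul, ← sub_eq_add_neg, ← sq_abs (x - μ)]
    exact pow_le_pow_left₀ ht (hs x hx) 2
  have hmarkov := mul_meas_ge_le_integral_of_nonneg
    (ae_of_all _ fun x => sq_nonneg (1 * x + -μ)) hint (t ^ 2)
  rw [integral_affine_sq_gaussianReal] at hmarkov
  calc (gaussianReal μ v).real s * t ^ 2 ≤
        (gaussianReal μ v).real {x | t ^ 2 ≤ (1 * x + -μ) ^ 2} * t ^ 2 :=
        mul_le_mul_of_nonneg_right (measureReal_mono hsub) (sq_nonneg t)
    _ ≤ (v : ℝ) := by linarith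

lemma gaussianReal_Iio_mul_sq_le {a : ℝ} (ha : a ≤ μ) :
    (gaussianReal μ v).real (Set.Iio a) * (μ - a) ^ 2 ≤ v :=
  gaussianReal_real_mul_sq_le μ v (sub_nonneg.2 ha) fun x hx => by
    rw [abs_sub_comm]
    exact (sub_le_sub_left (Set.mem_Iio.1 hx).le μ).trans (le_abs_self _)

lemma gaussianReal_Ioi_mul_sq_le {a : ℝ} (ha : μ ≤ a) :
    (gaussianReal μ v).real (Set.Ioi a) * (a - μ) ^ 2 ≤ v :=
  gaussianReal_real_mul_sq_le μ v (sub_nonneg.2 ha) fun _ hx =>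
    (sub_le_sub_right (Set.mem_Ioi.1 hx).le μ).trans (le_abs_self _)

lemma gaussianReal_Icc_mul_sq_le {lam : ℝ} (h : lam ≤ |μ|) :
    (gaussianReal μ v).real (Set.Icc (-lam) lam) * (|μ| - lam) ^ 2 ≤ v :=
  gaussianReal_real_mul_sq_le μ v (sub_nonneg.2 h) fun x hx => by
    rw [abs_sub_comm]
    linarith [abs_sub_abs_le_abs_sub μ x, abs_le.2 hx]

variable {v} in
lemma hasSubgaussianMGF_sub_gaussianReal {w : ℝ≥0} (hvw : v ≤ w) :
    HasSubgaussianMGF (fun x => x - μ) w (gaussianReal μ v) := by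
  have hlaw : HasLaw (fun x => x - μ) (gaussianReal 0 v) (gaussianReal μ v) :=
    ⟨by fun_prop, by rw [gaussianReal_map_sub_const, sub_self]⟩
  refine ⟨fun t => ?_, fun t => ?_⟩
  · simpa only [mul_sub, sub_eq_add_neg (t * _), Real.exp_add] using
      (integrable_exp_mul_gaussianReal t).mul_const (Real.exp (-(t * μ)))
  · rw [mgf_gaussianReal hlaw.map_eq, zero_mul, zero_add]
    have : (v : ℝ) ≤ w := hvw
    gcongr

variable {v} in
lemma gaussianReal_Icc_le_exp {w : ℝ≥0} (hvw : v ≤ w) {lam t : ℝ} (ht : 0 ≤ t)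
    (hμ : lam + t ≤ |μ|) :
    (gaussianReal μ v).real (Set.Icc (-lam) lam) ≤ Real.exp (-t ^ 2 / (2 * w)) := by
  have hsub := hasSubgaussianMGF_sub_gaussianReal μ hvw
  rcases abs_cases μ with ⟨habs, -⟩ | ⟨habs, -⟩
  · refine (measureReal_mono fun x hx => ?_).trans (hsub.neg.measure_ge_le ht)
    simp only [Set.mem_ofPred_eq, Pi.neg_apply]
    linarith [hx.2]
  · refine (measureReal_mono fun x hx => ?_).trans (hsub.measure_ge_le ht)
    simp only [Set.mem_ofPred_eq]
    linarith [hx.1]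

variable {v} in
/-- The second moment of an order `N` Hermite sum grows like `exp (μ ^ 2 / (1 - v))`; the
probability that `V` falls below the threshold beats this growth as soon as `3 * w < 1`. -/
lemma gaussianReal_Icc_mul_exp_le {w : ℝ≥0} (hvw : v ≤ w) (hw0 : (0 : ℝ) < w)
    (hw : 3 * (w : ℝ) < 1) (lam : ℝ) :
    (gaussianReal μ v).real (Set.Icc (-lam) lam) * Real.exp (μ ^ 2 / (1 - v)) ≤
      Real.exp (lam ^ 2 / (1 - 3 * w)) := by
  have hvw' : (v : ℝ) ≤ w := hvw
  have hexp : μ ^ 2 / (1 - v) ≤ |μ| ^ 2 / (1 - w) := by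
    rw [sq_abs]
    gcongr
    linarith
  rcases le_total |μ| lam with h | h
  · refine (mul_le_of_le_one_left (Real.exp_pos _).le measureReal_le_one).trans ?_
    refine Real.exp_le_exp.2 (hexp.trans ?_)
    have : 0 < 1 - 3 * (w : ℝ) := by linarith
    gcongr
    linarith
  · have htail := gaussianReal_Icc_le_exp μ hvw (lam := lam) (sub_nonneg.2 h) (by linarith)
    have hsedrakyan : |μ| ^ 2 / (1 - w) ≤ (|μ| - lam) ^ 2 / (2 * w) + lam ^ 2 / (1 - 3 * w) := by
      have hg : ∀ i ∈ Finset.univ, 0 < (![2 * (w : ℝ), 1 - 3 * w] : Fin 2 → ℝ) i := by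
        simp [Fin.forall_fin_two, hw0, hw]
      have := Finset.univ.sq_sum_div_le_sum_sq_div ![|μ| - lam, lam] hg
      simp only [Fin.sum_univ_two, Matrix.cons_val_zero, Matrix.cons_val_one] at this
      rwa [sub_add_cancel, show 2 * (w : ℝ) + (1 - 3 * w) = 1 - w by ring] at this
    calc _ ≤ Real.exp (-(|μ| - lam) ^ 2 / (2 * w)) * Real.exp (|μ| ^ 2 / (1 - w)) := by gcongr
      _ = Real.exp (-(|μ| - lam) ^ 2 / (2 * w) + |μ| ^ 2 / (1 - w)) := (Real.exp_add _ _).symm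
      _ ≤ _ := by
        rw [neg_div]
        gcongr
        linarith

end GaussianProbabilities

section CheckLossBounds

/-- The check loss `μ⁺ - β μ`, which the two outer branches of the threshold estimate estimate
without bias and from which `G(μ, β)` differs little for large `|μ|`. -/
def checkLoss (β μ : ℝ) : ℝ := max μ 0 - β * μ

variable {β : ℝ}

lemma checkLoss_of_nonneg (β : ℝ) {μ : ℝ} (hμ : 0 ≤ μ) : checkLoss β μ = (1 - β) * μ := by
  rw [checkLoss, max_eq_left hμ]
  ring

lemma checkLoss_of_nonpos (β : ℝ) {μ : ℝ} (hμ : μ ≤ 0) : checkLoss β μ = -(β * μ) := by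
  rw [checkLoss, max_eq_right hμ, zero_sub]

lemma abs_checkLoss_le (hβ : β ∈ Set.Icc 0 1) (μ : ℝ) : |checkLoss β μ| ≤ |μ| := by
  rcases le_total 0 μ with hμ | hμ
  · rw [checkLoss_of_nonneg β hμ, abs_mul]
    exact mul_le_of_le_one_left (abs_nonneg μ) (abs_le.2 ⟨by linarith [hβ.2], by linarith [hβ.1]⟩)
  · rw [checkLoss_of_nonpos β hμ, abs_neg, abs_mul]
    exact mul_le_of_le_one_left (abs_nonneg μ) (abs_le.2 ⟨by linarith [hβ.1], hβ.2⟩)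

lemma stdPDF_mul_sq_le (μ : ℝ) : stdPDF μ * μ ^ 2 ≤ 2 := by
  have hexp : Real.exp (-(μ ^ 2 / 2)) * (μ ^ 2 / 2) ≤ 1 := by
    rw [Real.exp_neg, inv_mul_le_one₀ (Real.exp_pos _)]
    linarith [Real.add_one_le_exp (μ ^ 2 / 2)]
  calc stdPDF μ * μ ^ 2 = stdPDF 0 * (Real.exp (-(μ ^ 2 / 2)) * (μ ^ 2 / 2)) * 2 := by
        rw [stdPDF_eq_mul_exp]
        ring
    _ ≤ 1 * 1 * 2 := by
        gcongr
        exact stdPDF_zero_le_one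
    _ = 2 := by norm_num

lemma stdPDF_le_one (μ : ℝ) : stdPDF μ ≤ 1 := by
  rw [stdPDF_eq_mul_exp]
  exact mul_le_one₀ stdPDF_zero_le_one (Real.exp_pos _).le (Real.exp_le_one_iff.2 (by
    rw [neg_nonpos]
    positivity))

lemma stdCDF_mul_sq_le {μ : ℝ} (hμ : μ ≤ 0) : stdCDF μ * μ ^ 2 ≤ 1 := by
  rw [stdCDF, cdf_eq_real, ← neg_sq]
  exact_mod_cast gaussianReal_real_mul_sq_le 0 1 (neg_nonneg.2 hμ) fun x hx => by
    rw [sub_zero]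
    exact (neg_le_neg hx).trans (neg_le_abs x)

lemma one_sub_stdCDF_mul_sq_le {μ : ℝ} (hμ : 0 ≤ μ) : (1 - stdCDF μ) * μ ^ 2 ≤ 1 := by
  rw [stdCDF, cdf_eq_real, ← probReal_compl_eq_one_sub measurableSet_Iic, Set.compl_Iic]
  exact_mod_cast gaussianReal_real_mul_sq_le 0 1 hμ fun x hx => by
    rw [sub_zero]
    exact (le_of_lt hx).trans (le_abs_self x)

lemma exists_G_sub_checkLoss_eq (β μ : ℝ) : ∃ q ∈ Set.Icc (0 : ℝ) 1, q * μ ^ 2 ≤ 1 ∧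
    G μ β - checkLoss β μ = stdPDF μ - q * |μ| := by
  rcases le_total 0 μ with hμ | hμ
  · refine ⟨1 - stdCDF μ, ⟨by linarith [stdCDF_le_one μ], by linarith [stdCDF_nonneg μ]⟩,
      one_sub_stdCDF_mul_sq_le hμ, ?_⟩
    rw [checkLoss_of_nonneg β hμ, abs_of_nonneg hμ, G]
    ring
  · refine ⟨stdCDF μ, ⟨stdCDF_nonneg μ, stdCDF_le_one μ⟩, stdCDF_mul_sq_le hμ, ?_⟩
    rw [checkLoss_of_nonpos β hμ, abs_of_nonpos hμ, G]
    ring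

lemma abs_G_sub_checkLoss_mul_le (β μ : ℝ) : |G μ β - checkLoss β μ| * (1 + |μ|) ≤ 3 := by
  obtain ⟨q, ⟨hq0, hq1⟩, hqμ, heq⟩ := exists_G_sub_checkLoss_eq β μ
  have hmean : 2 * |μ| ≤ 1 + μ ^ 2 := by nlinarith [sq_nonneg (|μ| - 1), sq_abs μ]
  have hφ : stdPDF μ * (1 + |μ|) ≤ 3 := by
    nlinarith [stdPDF_le_one μ, stdPDF_nonneg μ, stdPDF_mul_sq_le μ]
  have hq : q * |μ| * (1 + |μ|) ≤ 3 := by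
    rw [mul_assoc, mul_one_add, abs_mul_abs_self]
    nlinarith
  have hmax : |G μ β - checkLoss β μ| ≤ max (stdPDF μ) (q * |μ|) := by
    rw [heq]
    exact abs_sub_le_iff.2 ⟨(sub_le_self _ (by positivity)).trans (le_max_left _ _),
      (sub_le_self _ (stdPDF_nonneg μ)).trans (le_max_right _ _)⟩
  calc _ ≤ max (stdPDF μ) (q * |μ|) * (1 + |μ|) := by gcongr
    _ = max (stdPDF μ * (1 + |μ|)) (q * |μ| * (1 + |μ|)) := max_mul_of_nonneg _ _ (by positivity)
    _ ≤ 3 := max_le hφ hq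

lemma abs_G_sub_checkLoss_le (β μ : ℝ) : |G μ β - checkLoss β μ| ≤ 3 :=
  (le_mul_of_one_le_right (abs_nonneg _) (le_add_of_nonneg_right (abs_nonneg μ))).trans
    (abs_G_sub_checkLoss_mul_le β μ)

lemma abs_G_le (hβ : β ∈ Set.Icc 0 1) (μ : ℝ) : |G μ β| ≤ |μ| + 3 := by
  calc |G μ β| = |checkLoss β μ + (G μ β - checkLoss β μ)| := by rw [add_sub_cancel]
    _ ≤ |checkLoss β μ| + |G μ β - checkLoss β μ| := abs_add_le _ _
    _ ≤ |μ| + 3 := add_le_add (abs_checkLoss_le hβ μ) (abs_G_sub_checkLoss_le β μ)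

end CheckLossBounds

section Switch

/-- The function of `(u, v)` equal to `f u`, `g u` or `h u` according to whether `v` lies to the
left of, in, or to the right of `[-lam, lam]`. -/
def switch (lam : ℝ) (f g h : ℝ → ℝ) (p : ℝ × ℝ) : ℝ :=
  if p.2 < -lam then f p.1 else if p.2 ≤ lam then g p.1 else h p.1

variable {lam : ℝ} {f g h : ℝ → ℝ}

lemma comp_switch (F : ℝ → ℝ) (p : ℝ × ℝ) :
    F (switch lam f g h p) =
      switch lam (fun u => F (f u)) (fun u => F (g u)) (fun u => F (h u)) p := by
  unfold switch
  split_ifs <;> rfl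

lemma switch_eq_add (hlam : 0 ≤ lam) (p : ℝ × ℝ) :
    switch lam f g h p = f p.1 * (Set.Iio (-lam)).indicator 1 p.2 +
      g p.1 * (Set.Icc (-lam) lam).indicator 1 p.2 + h p.1 * (Set.Ioi lam).indicator 1 p.2 := by
  simp only [switch, Set.indicator_apply, Set.mem_Iio, Set.mem_Icc, Set.mem_Ioi, Pi.one_apply]
  grind

variable {ρ ν : Measure ℝ} [IsFiniteMeasure ν]

lemma integrable_mul_indicator {s : Set ℝ} (hs : MeasurableSet s) (hf : Integrable f ρ) :
    Integrable (fun p : ℝ × ℝ => f p.1 * s.indicator 1 p.2) (ρ.prod ν) :=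
  hf.mul_prod ((integrable_const (1 : ℝ)).indicator hs)

lemma integrable_switch (hlam : 0 ≤ lam) (hf : Integrable f ρ) (hg : Integrable g ρ)
    (hh : Integrable h ρ) : Integrable (switch lam f g h) (ρ.prod ν) := by
  rw [funext (switch_eq_add hlam)]
  exact ((integrable_mul_indicator measurableSet_Iio hf).add
    (integrable_mul_indicator measurableSet_Icc hg)).add
    (integrable_mul_indicator measurableSet_Ioi hh)

lemma memLp_two_switch (hlam : 0 ≤ lam) [IsFiniteMeasure ρ] (hf : MemLp f 2 ρ) (hg : MemLp g 2 ρ)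
    (hh : MemLp h 2 ρ) : MemLp (switch lam f g h) 2 (ρ.prod ν) := by
  have hmeas := (integrable_switch (ν := ν) hlam (hf.integrable one_le_two)
    (hg.integrable one_le_two) (hh.integrable one_le_two)).aestronglyMeasurable
  rw [memLp_two_iff_integrable_sq hmeas]
  simp_rw [comp_switch (· ^ 2)]
  exact integrable_switch hlam hf.integrable_sq hg.integrable_sq hh.integrable_sq

variable [SFinite ρ]

lemma integral_mul_indicator {s : Set ℝ} (hs : MeasurableSet s) (f : ℝ → ℝ) :
    ∫ p, f p.1 * s.indicator 1 p.2 ∂ρ.prod ν = ν.real s * ∫ x, f x ∂ρ := by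
  rw [integral_prod_mul f (s.indicator 1), integral_indicator_one hs, mul_comm]

lemma integral_switch (hlam : 0 ≤ lam) (hf : Integrable f ρ) (hg : Integrable g ρ)
    (hh : Integrable h ρ) :
    ∫ p, switch lam f g h p ∂ρ.prod ν =
      ν.real (Set.Iio (-lam)) * ∫ x, f x ∂ρ + ν.real (Set.Icc (-lam) lam) * ∫ x, g x ∂ρ +
        ν.real (Set.Ioi lam) * ∫ x, h x ∂ρ := by
  have hleft := integrable_mul_indicator (ν := ν) (measurableSet_Iio (a := -lam)) hf
  have hmid := integrable_mul_indicator (ν := ν) (measurableSet_Icc (a := -lam) (b := lam)) hg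
  have hright := integrable_mul_indicator (ν := ν) (measurableSet_Ioi (a := lam)) hh
  simp_rw [switch_eq_add hlam]
  rw [integral_add (hleft.fun_add hmid) hright, integral_add hleft hmid,
    integral_mul_indicator measurableSet_Iio, integral_mul_indicator measurableSet_Icc,
    integral_mul_indicator measurableSet_Ioi]

lemma real_Iio_add_Icc_add_Ioi (hlam : 0 ≤ lam) (ν : Measure ℝ) [IsProbabilityMeasure ν] :
    ν.real (Set.Iio (-lam)) + ν.real (Set.Icc (-lam) lam) + ν.real (Set.Ioi lam) = 1 := by
  have hone : Integrable (fun _ => (1 : ℝ)) ν := integrable_const 1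
  simpa [switch] using (integral_switch (ν := ν) hlam hone hone hone).symm

end Switch

section Clip

/-- Truncation of `s` at absolute value `n`, in the form used by the estimate `S̃`. -/
def clip (n s : ℝ) : ℝ := Real.sign s * min |s| n

variable {n : ℝ}

lemma abs_clip (hn : 0 ≤ n) (s : ℝ) : |clip n s| = min |s| n := by
  rcases lt_trichotomy s 0 with h | h | h
  · rw [clip, Real.sign_of_neg h, neg_one_mul, abs_neg, abs_of_nonneg (by positivity)]
  · rw [clip, h, Real.sign_zero, zero_mul, abs_zero, min_eq_left hn]
  · rw [clip, Real.sign_of_pos h, one_mul, abs_of_nonneg (by positivity)]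

lemma abs_clip_le_abs (hn : 0 ≤ n) (s : ℝ) : |clip n s| ≤ |s| :=
  (abs_clip hn s).trans_le (min_le_left _ _)

lemma abs_clip_sub_le (hn : 0 < n) (s : ℝ) : |clip n s - s| ≤ s ^ 2 / n := by
  have hle : |clip n s - s| ≤ |s| - min |s| n := by
    have hmin := min_le_left |s| n
    rcases lt_trichotomy s 0 with h | rfl | h
    · rw [clip, Real.sign_of_neg h, abs_of_neg h] at *
      rw [abs_le]
      constructor <;> linarith
    · simp [clip, hn.le]
    · rw [clip, Real.sign_of_pos h, abs_of_pos h] at *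
      rw [abs_le]
      constructor <;> linarith
  rw [le_div_iff₀ hn, ← sq_abs s]
  rcases le_total |s| n with h | h
  · rw [min_eq_left h, sub_self] at hle
    nlinarith [sq_nonneg |s|]
  · rw [min_eq_right h] at hle
    nlinarith

lemma measurable_clip (n : ℝ) : Measurable (clip n) := by
  have hsign : Measurable Real.sign :=
    measurable_const.ite measurableSet_Iio (measurable_const.ite measurableSet_Ioi measurable_const)
  exact hsign.mul (by fun_prop)

variable {ρ : Measure ℝ} {f : ℝ → ℝ}

lemma memLp_two_clip (hn : 0 ≤ n) (hf : MemLp f 2 ρ) : MemLp (fun x => clip n (f x)) 2 ρ :=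
  hf.mono ((measurable_clip n).comp_aemeasurable hf.1.aemeasurable).aestronglyMeasurable
    (ae_of_all _ fun x => abs_clip_le_abs hn (f x))

lemma integral_clip_sq_le (hn : 0 ≤ n) (hf : MemLp f 2 ρ) :
    ∫ x, clip n (f x) ^ 2 ∂ρ ≤ ∫ x, f x ^ 2 ∂ρ :=
  integral_mono (memLp_two_clip hn hf).integrable_sq hf.integrable_sq fun x =>
    sq_le_sq.2 (abs_clip_le_abs hn (f x))

lemma abs_integral_clip_sub_le [IsFiniteMeasure ρ] (hn : 0 < n) (hf : MemLp f 2 ρ) :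
    |∫ x, clip n (f x) ∂ρ - ∫ x, f x ∂ρ| ≤ (∫ x, f x ^ 2 ∂ρ) / n := by
  have hint := hf.integrable one_le_two
  have hclip := (memLp_two_clip hn.le hf).integrable one_le_two
  rw [← integral_sub hclip hint, ← integral_div]
  exact abs_integral_le_integral_abs.trans (integral_mono (hclip.sub hint).abs
    (hf.integrable_sq.div_const n) fun x => abs_clip_sub_le hn (f x))

end Clip

section SwitchEstimate

/-- The threshold estimate with an arbitrary central branch `s`. -/
def switchEst (β lam : ℝ) (s : ℝ → ℝ) : ℝ × ℝ → ℝ :=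
  switch lam (fun u => -(β * u)) s fun u => (1 - β) * u

section WrongSide

variable {p m lam v : ℝ}

lemma mul_posPart_sq_le (hlam : 0 ≤ lam) (hp : 0 ≤ p) (hpm : -lam ≤ m → p * (lam + m) ^ 2 ≤ v)
    (hv : 0 ≤ v) : p * max m 0 ^ 2 ≤ v := by
  rcases le_total m 0 with hm | hm
  · simpa [hm] using hv
  · rw [max_eq_left hm]
    exact (mul_le_mul_of_nonneg_left (by nlinarith) hp).trans (hpm (by linarith))

lemma mul_posPart_le (hlam : 0 < lam) (hp : 0 ≤ p) (hpm : -lam ≤ m → p * (lam + m) ^ 2 ≤ v)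
    (hv : 0 ≤ v) : p * max m 0 ≤ v / (4 * lam) := by
  rw [le_div_iff₀ (by positivity)]
  rcases le_total m 0 with hm | hm
  · simpa [hm] using hv
  · rw [max_eq_left hm]
    have hsq : m * (4 * lam) ≤ (lam + m) ^ 2 := by nlinarith [sq_nonneg (lam - m)]
    rw [mul_assoc]
    exact (mul_le_mul_of_nonneg_left hsq hp).trans (hpm (by linarith))

lemma mul_le_of_mul_one_add_abs_le {g : ℝ} (hlam : 0 < lam) (hp : p ∈ Set.Icc 0 1)
    (hpm : -lam ≤ m → p * (lam + m) ^ 2 ≤ v) (hv : 0 ≤ v) (hg0 : 0 ≤ g)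
    (hg : g * (1 + |m|) ≤ 3) : p * g ≤ (6 + 3 * v) / lam := by
  obtain ⟨hp0, hp1⟩ := hp
  rw [le_div_iff₀ hlam]
  have hpg : p * g ≤ g := mul_le_of_le_one_left hg0 hp1
  rcases le_total m (-(lam / 2)) with hm | hm
  · have hm' : lam / 2 ≤ |m| := by linarith [neg_le_abs m]
    have hglam : g * (lam / 2) ≤ 3 := by nlinarith
    nlinarith
  · have hg3 : g ≤ 3 := by nlinarith [abs_nonneg m]
    have hplam : p * (lam / 2) ^ 2 ≤ v := (mul_le_mul_of_nonneg_left
      (by nlinarith) hp0).trans (hpm (by linarith))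
    have hsq : (p * lam) ^ 2 ≤ 4 * v := by nlinarith [mul_nonneg hp0 (sq_nonneg lam)]
    have hle : p * lam ≤ 1 + v := by nlinarith [sq_nonneg (p * lam - 2)]
    nlinarith [mul_nonneg hp0 hlam.le]

/-- Bounds the contribution to the bias of the event, of probability `p`, that `V` falls on the
wrong side of the threshold: `m` is its signed mean and `g` the distance from `G` to the check
loss. -/
lemma mul_posPart_add_le {g : ℝ} (hlam : 0 < lam) (hp : p ∈ Set.Icc 0 1)
    (hpm : -lam ≤ m → p * (lam + m) ^ 2 ≤ v) (hv : 0 ≤ v) (hg0 : 0 ≤ g)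
    (hg : g * (1 + |m|) ≤ 3) : p * (max m 0 + g) ≤ 6 * (1 + v) / lam := by
  calc p * (max m 0 + g) = p * max m 0 + p * g := mul_add _ _ _
    _ ≤ v / (4 * lam) + (6 + 3 * v) / lam :=
        add_le_add (mul_posPart_le hlam hp.1 hpm hv)
          (mul_le_of_mul_one_add_abs_le hlam hp hpm hv hg0 hg)
    _ = (6 + 13 / 4 * v) / lam := by field_simp; ring
    _ ≤ 6 * (1 + v) / lam := by gcongr; linarith

end WrongSide

variable {β lam : ℝ} {s : ℝ → ℝ} (μ : ℝ) (v : ℝ≥0)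

lemma memLp_two_mul_left_gaussianReal (a : ℝ) : MemLp (fun x => a * x) 2 (gaussianReal μ v) := by
  simpa using (memLp_two_eval_gaussianReal μ v Polynomial.X).const_mul a

lemma memLp_two_switchEst (hlam : 0 ≤ lam) (hs : MemLp s 2 (gaussianReal μ v)) :
    MemLp (switchEst β lam s) 2 ((gaussianReal μ v).prod (gaussianReal μ v)) :=
  memLp_two_switch hlam (memLp_two_mul_left_gaussianReal μ v β).neg hs
    (memLp_two_mul_left_gaussianReal μ v (1 - β))

lemma max_neg_zero_eq_sub (x : ℝ) : max (-x) 0 = max x 0 - x := by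
  rw [← max_sub_sub_right, sub_self, zero_sub, max_comm]

lemma integral_switchEst_sub (hlam : 0 ≤ lam) (hs : Integrable s (gaussianReal μ v)) (a : ℝ) :
    ∫ p, switchEst β lam s p ∂(gaussianReal μ v).prod (gaussianReal μ v) - a =
      (gaussianReal μ v).real (Set.Iio (-lam)) * (checkLoss β μ - max μ 0 - a) +
      (gaussianReal μ v).real (Set.Icc (-lam) lam) * (∫ x, s x ∂gaussianReal μ v - a) +
      (gaussianReal μ v).real (Set.Ioi lam) * (checkLoss β μ - max (-μ) 0 - a) := by
  have hlin := fun a => (memLp_two_mul_left_gaussianReal μ v a).integrable one_le_two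
  rw [switchEst, integral_switch hlam (hlin β).fun_neg hs (hlin (1 - β)), integral_neg,
    integral_const_mul, integral_const_mul, integral_id_gaussianReal, max_neg_zero_eq_sub,
    checkLoss]
  linear_combination a * real_Iio_add_Icc_add_Ioi hlam (gaussianReal μ v)

lemma gaussianReal_Iio_neg_mul_sq_le (h : -lam ≤ μ) :
    (gaussianReal μ v).real (Set.Iio (-lam)) * (lam + μ) ^ 2 ≤ v := by
  simpa [add_comm] using gaussianReal_Iio_mul_sq_le μ v h

lemma gaussianReal_Ioi_mul_sq_neg_le (h : -lam ≤ -μ) :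
    (gaussianReal μ v).real (Set.Ioi lam) * (lam + -μ) ^ 2 ≤ v := by
  simpa [← sub_eq_add_neg] using gaussianReal_Ioi_mul_sq_le μ v (neg_le_neg_iff.1 h)

lemma abs_integral_switchEst_sub_G_le (hlam : 0 < lam) (hs : Integrable s (gaussianReal μ v)) :
    |∫ p, switchEst β lam s p ∂(gaussianReal μ v).prod (gaussianReal μ v) - G μ β| ≤
      12 * (1 + v) / lam + (gaussianReal μ v).real (Set.Icc (-lam) lam) *
        |∫ x, s x ∂gaussianReal μ v - G μ β| := by
  have hprob : ∀ s : Set ℝ, (gaussianReal μ v).real s ∈ Set.Icc (0 : ℝ) 1 := fun _ =>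
    ⟨measureReal_nonneg, measureReal_le_one⟩
  have hleft := mul_posPart_add_le hlam (hprob _) (gaussianReal_Iio_neg_mul_sq_le μ v)
    v.coe_nonneg (abs_nonneg _) (abs_G_sub_checkLoss_mul_le β μ)
  have hright := mul_posPart_add_le (m := -μ) hlam (hprob _) (gaussianReal_Ioi_mul_sq_neg_le μ v)
    v.coe_nonneg (abs_nonneg _) ((abs_neg μ).symm ▸ abs_G_sub_checkLoss_mul_le β μ)
  have habs : ∀ q, |checkLoss β μ - max q 0 - G μ β| ≤
      max q 0 + |G μ β - checkLoss β μ| := fun q => by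
    have hq : 0 ≤ max q 0 := le_max_right _ _
    rw [abs_le]
    constructor <;> linarith [le_abs_self (G μ β - checkLoss β μ),
      neg_abs_le (G μ β - checkLoss β μ)]
  rw [integral_switchEst_sub μ v hlam.le hs]
  refine (abs_add_three _ _ _).trans ?_
  simp only [abs_mul, abs_of_nonneg (hprob _).1]
  have := mul_le_mul_of_nonneg_left (habs μ) (hprob (Set.Iio (-lam))).1
  have := mul_le_mul_of_nonneg_left (habs (-μ)) (hprob (Set.Ioi lam)).1
  have hsum : 12 * (1 + v) / lam = 6 * (1 + v) / lam + 6 * (1 + v) / lam := by ring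
  linarith

lemma gaussianReal_Icc_mul_mean_sq_le (lam : ℝ) :
    (gaussianReal μ v).real (Set.Icc (-lam) lam) * μ ^ 2 ≤ 2 * lam ^ 2 + 2 * v := by
  have hp0 : 0 ≤ (gaussianReal μ v).real (Set.Icc (-lam) lam) := measureReal_nonneg
  have hp1 : (gaussianReal μ v).real (Set.Icc (-lam) lam) ≤ 1 := measureReal_le_one
  rw [← sq_abs μ]
  rcases le_total lam |μ| with h | h
  · have htail := gaussianReal_Icc_mul_sq_le μ v h
    have hsq : |μ| ^ 2 ≤ 2 * (|μ| - lam) ^ 2 + 2 * lam ^ 2 := by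
      nlinarith [sq_nonneg (|μ| - 2 * lam)]
    nlinarith [sq_nonneg lam]
  · have hsq : |μ| ^ 2 ≤ lam ^ 2 := by gcongr
    nlinarith [v.coe_nonneg, sq_nonneg |μ|]

lemma integral_sub_const_sq_le {ρ : Measure ℝ} [IsProbabilityMeasure ρ] (hs : MemLp s 2 ρ) (a : ℝ) :
    ∫ x, (s x - a) ^ 2 ∂ρ ≤ 2 * ∫ x, s x ^ 2 ∂ρ + 2 * a ^ 2 := by
  have hconst : Integrable (fun _ => a ^ 2) ρ := integrable_const _
  calc ∫ x, (s x - a) ^ 2 ∂ρ ≤ ∫ x, 2 * s x ^ 2 + 2 * a ^ 2 ∂ρ :=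
        integral_mono (hs.sub (memLp_const a)).integrable_sq
          ((hs.integrable_sq.const_mul 2).add (hconst.const_mul 2))
          fun x => by linarith [sq_nonneg (s x + a)]
    _ = 2 * ∫ x, s x ^ 2 ∂ρ + 2 * a ^ 2 := by
        rw [integral_add (hs.integrable_sq.const_mul 2) (hconst.const_mul 2),
          integral_const_mul, integral_const, probReal_univ, one_smul]

lemma integral_switchEst_sub_checkLoss_sq (hlam : 0 ≤ lam) (hs : MemLp s 2 (gaussianReal μ v)) :
    ∫ p, (switchEst β lam s p - checkLoss β μ) ^ 2 ∂(gaussianReal μ v).prod (gaussianReal μ v) =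
      (gaussianReal μ v).real (Set.Iio (-lam)) * (β ^ 2 * v + max μ 0 ^ 2) +
      (gaussianReal μ v).real (Set.Icc (-lam) lam) *
        ∫ x, (s x - checkLoss β μ) ^ 2 ∂gaussianReal μ v +
      (gaussianReal μ v).real (Set.Ioi lam) * ((1 - β) ^ 2 * v + max (-μ) 0 ^ 2) := by
  have hint {f : ℝ → ℝ} (hf : MemLp f 2 (gaussianReal μ v)) :
      Integrable (fun x => (f x + -checkLoss β μ) ^ 2) (gaussianReal μ v) :=
    (hf.add (memLp_const _)).integrable_sq
  have hlin := fun b => hint (memLp_two_mul_left_gaussianReal μ v b)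
  have hsq := fun b => integral_affine_sq_gaussianReal μ v b (-checkLoss β μ)
  simp_rw [switchEst, comp_switch fun y => (y - checkLoss β μ) ^ 2,
    sub_eq_add_neg _ (checkLoss β μ), ← neg_mul]
  rw [integral_switch hlam (hlin (-β)) (hint hs) (hlin (1 - β)), hsq, hsq, max_neg_zero_eq_sub]
  simp only [checkLoss]
  ring

lemma variance_switchEst_le (hβ : β ∈ Set.Icc 0 1) (hlam : 0 ≤ lam)
    (hs : MemLp s 2 (gaussianReal μ v)) :
    variance (switchEst β lam s) ((gaussianReal μ v).prod (gaussianReal μ v)) ≤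
      2 * ((gaussianReal μ v).real (Set.Icc (-lam) lam) * ∫ x, s x ^ 2 ∂gaussianReal μ v) +
        4 * lam ^ 2 + 7 * v := by
  have hest := memLp_two_switchEst (β := β) μ v hlam hs
  have hleft := mul_posPart_sq_le hlam measureReal_nonneg (gaussianReal_Iio_neg_mul_sq_le μ v)
    v.coe_nonneg
  have hright := mul_posPart_sq_le hlam measureReal_nonneg (gaussianReal_Ioi_mul_sq_neg_le μ v)
    v.coe_nonneg
  have hmid := gaussianReal_Icc_mul_mean_sq_le μ v lam
  have hsum := real_Iio_add_Icc_add_Ioi hlam (gaussianReal μ v)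
  have hloss : checkLoss β μ ^ 2 ≤ μ ^ 2 := sq_le_sq.2 (abs_checkLoss_le hβ μ)
  have hsub := integral_sub_const_sq_le hs (checkLoss β μ)
  rw [← variance_sub_const hest.aestronglyMeasurable (checkLoss β μ)]
  refine (variance_le_expectation_sq (hest.sub (memLp_const _)).aestronglyMeasurable).trans ?_
  simp only [Pi.pow_apply, Pi.sub_apply]
  rw [integral_switchEst_sub_checkLoss_sq μ v hlam hs]
  have hA : 0 ≤ (gaussianReal μ v).real (Set.Iio (-lam)) := measureReal_nonneg
  have hB : 0 ≤ (gaussianReal μ v).real (Set.Icc (-lam) lam) := measureReal_nonneg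
  have hC : 0 ≤ (gaussianReal μ v).real (Set.Ioi lam) := measureReal_nonneg
  have hβv : β ^ 2 * v ≤ v := mul_le_of_le_one_left v.coe_nonneg (pow_le_one₀ hβ.1 hβ.2)
  have hβv' : (1 - β) ^ 2 * v ≤ v := mul_le_of_le_one_left v.coe_nonneg
    (pow_le_one₀ (by linarith [hβ.2]) (by linarith [hβ.1]))
  have := mul_le_mul_of_nonneg_left hβv hA
  have := mul_le_mul_of_nonneg_left hβv' hC
  have := mul_le_mul_of_nonneg_left (hsub.trans (by gcongr : _ ≤
    2 * ∫ x, s x ^ 2 ∂gaussianReal μ v + 2 * μ ^ 2)) hB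
  have := mul_nonneg hB v.coe_nonneg
  linarith [congrArg (· * (v : ℝ)) hsum]

end SwitchEstimate

section HermiteEstimate

/-- The estimate `T̂` as a function of the pair `(U, V)`, with threshold `lam`, clipping level `n`,
and the Taylor polynomial of degree `M + 1` estimated through Hermite polynomials of variance
`v`. -/
def hermiteEst (β lam n : ℝ) (M : ℕ) (v : ℝ) : ℝ × ℝ → ℝ :=
  switchEst β lam fun u => clip n ((hermiteSum (taylorCoef β) v (M + 2)).eval u)

variable {β lam n D : ℝ} {M : ℕ} {v w : ℝ≥0} (μ : ℝ)

lemma memLp_two_hermiteEst (hlam : 0 ≤ lam) (hn : 0 ≤ n) (v : ℝ≥0) :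
    MemLp (hermiteEst β lam n M v) 2 ((gaussianReal μ v).prod (gaussianReal μ v)) :=
  memLp_two_switchEst μ v hlam (memLp_two_clip hn (memLp_two_eval_gaussianReal μ v _))

lemma gaussianReal_Icc_mul_integral_hermiteSum_sq_le (hβ : β ∈ Set.Icc 0 1) (hvw : v ≤ w)
    (hw0 : (0 : ℝ) < w) (hw : 3 * (w : ℝ) < 1) (lam : ℝ) (M : ℕ) :
    (gaussianReal μ v).real (Set.Icc (-lam) lam) *
        ∫ x, (hermiteSum (taylorCoef β) v (M + 2)).eval x ^ 2 ∂gaussianReal μ v ≤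
      (M + 2) ^ 2 * Real.exp (lam ^ 2 / (1 - 3 * w)) := by
  have hv1 : v < 1 := by
    have : (v : ℝ) ≤ w := hvw
    rw [← NNReal.coe_lt_coe, NNReal.coe_one]
    linarith
  have hsq := integral_hermiteSum_sq_le (taylorCoef_sq_mul_factorial_le hβ) μ hv1 (M + 2)
  push_cast at hsq
  calc _ ≤ (gaussianReal μ v).real (Set.Icc (-lam) lam) *
        ((M + 2) ^ 2 * Real.exp (μ ^ 2 / (1 - v))) :=
        mul_le_mul_of_nonneg_left hsq measureReal_nonneg
    _ = (M + 2) ^ 2 * ((gaussianReal μ v).real (Set.Icc (-lam) lam) *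
        Real.exp (μ ^ 2 / (1 - v))) := by ring
    _ ≤ _ := by
        gcongr
        exact gaussianReal_Icc_mul_exp_le μ hvw hw0 hw lam

lemma sq_integral_le_integral_sq {ρ : Measure ℝ} [IsProbabilityMeasure ρ] {f : ℝ → ℝ}
    (hf : MemLp f 2 ρ) : (∫ x, f x ∂ρ) ^ 2 ≤ ∫ x, f x ^ 2 ∂ρ := by
  have hvar := variance_nonneg f ρ
  rw [variance_eq_sub hf] at hvar
  simpa using sub_nonneg.1 hvar

lemma gaussianReal_Icc_mul_abs_sum_taylorCoef_le (hβ : β ∈ Set.Icc 0 1) (hvw : v ≤ w)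
    (hw0 : (0 : ℝ) < w) (hw : 3 * (w : ℝ) < 1) (hD : 0 ≤ D) (hμ : lam + D ≤ |μ|) (M : ℕ) :
    (gaussianReal μ v).real (Set.Icc (-lam) lam) *
        |∑ k ∈ Finset.range (M + 2), taylorCoef β k * μ ^ k| ≤
      (M + 2) * Real.exp ((lam ^ 2 / (1 - 3 * w) - D ^ 2 / (2 * w)) / 2) := by
  set p := (gaussianReal μ v).real (Set.Icc (-lam) lam)
  have hp : 0 ≤ p := measureReal_nonneg
  have hmean := sq_integral_le_integral_sq
    (memLp_two_eval_gaussianReal μ v (hermiteSum (taylorCoef β) v (M + 2)))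
  rw [integral_hermiteSum] at hmean
  refine abs_le_of_sq_le_sq' ?_ (by positivity) |>.2
  calc (p * |∑ k ∈ Finset.range (M + 2), taylorCoef β k * μ ^ k|) ^ 2
      = p * (p * (∑ k ∈ Finset.range (M + 2), taylorCoef β k * μ ^ k) ^ 2) := by
        rw [mul_pow, sq_abs]
        ring
    _ ≤ Real.exp (-D ^ 2 / (2 * w)) * ((M + 2) ^ 2 * Real.exp (lam ^ 2 / (1 - 3 * w))) :=
        mul_le_mul (gaussianReal_Icc_le_exp μ hvw hD hμ)
          ((mul_le_mul_of_nonneg_left hmean hp).trans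
            (gaussianReal_Icc_mul_integral_hermiteSum_sq_le μ hβ hvw hw0 hw lam M))
          (by positivity) (Real.exp_pos _).le
    _ = ((M + 2) * Real.exp ((lam ^ 2 / (1 - 3 * w) - D ^ 2 / (2 * w)) / 2)) ^ 2 := by
        rw [mul_pow, ← Real.exp_nat_mul, mul_left_comm, ← Real.exp_add]
        congr 2
        push_cast
        ring

lemma gaussianReal_Icc_mul_abs_G_le (hβ : β ∈ Set.Icc 0 1) (hvw : v ≤ w) (hD : 0 < D)
    (hlam : 0 ≤ lam) (hμ : lam + D ≤ |μ|) :
    (gaussianReal μ v).real (Set.Icc (-lam) lam) * |G μ β| ≤ w / D + (lam + 3) * w / D ^ 2 := by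
  set p := (gaussianReal μ v).real (Set.Icc (-lam) lam)
  have hp : 0 ≤ p := measureReal_nonneg
  have htail : p * (|μ| - lam) ^ 2 ≤ w :=
    (gaussianReal_Icc_mul_sq_le μ v (by linarith)).trans (NNReal.coe_le_coe.2 hvw)
  have hsq : p ≤ w / D ^ 2 := by
    rw [le_div_iff₀ (by positivity)]
    exact (mul_le_mul_of_nonneg_left (by gcongr; linarith) hp).trans htail
  have hlin : p * (|μ| - lam) ≤ w / D := by
    rw [le_div_iff₀ hD, mul_assoc]
    exact (mul_le_mul_of_nonneg_left (by nlinarith) hp).trans htail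
  calc p * |G μ β| ≤ p * (|μ| + 3) := mul_le_mul_of_nonneg_left (abs_G_le hβ μ) hp
    _ = p * (|μ| - lam) + (lam + 3) * p := by ring
    _ ≤ w / D + (lam + 3) * (w / D ^ 2) := by gcongr
    _ = _ := by ring

lemma mul_exp_neg_le {ε x : ℝ} (hε : 0 < ε) (hx : 0 < x) :
    x * Real.exp (-(ε * x)) ≤ 2 / (ε ^ 2 * x) := by
  have hquad := Real.quadratic_le_exp_of_nonneg (by positivity : 0 ≤ ε * x)
  rw [Real.exp_neg, ← div_eq_mul_inv, div_le_div_iff₀ (Real.exp_pos _) (by positivity)]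
  nlinarith [mul_pos hε hx]

lemma abs_sum_taylorCoef_sub_G_le_div (β : ℝ) {R : ℝ} (hR : 0 < R) (hμ : |μ| ≤ R)
    (hM : Real.exp 2 * R ^ 2 ≤ M) :
    |∑ k ∈ Finset.range (M + 2), taylorCoef β k * μ ^ k - G μ β| ≤ 16 / R ^ 2 := by
  have hμR : μ ^ 2 ≤ R ^ 2 := sq_le_sq.2 (by rwa [abs_of_pos hR])
  have hRM : R ^ 2 ≤ M := le_trans (le_mul_of_one_le_left (sq_nonneg R)
    (Real.one_le_exp two_pos.le)) hM
  calc _ ≤ 2 * Real.exp (-((M : ℝ) / 2)) * μ ^ 2 :=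
        abs_sum_taylorCoef_sub_G_le β ((mul_le_mul_of_nonneg_left hμR (Real.exp_pos 2).le).trans hM)
    _ ≤ 2 * Real.exp (-(R ^ 2 / 2)) * R ^ 2 := by gcongr
    _ = 2 * (R ^ 2 * Real.exp (-(1 / 2 * R ^ 2))) := by ring_nf
    _ ≤ 2 * (2 / ((1 / 2) ^ 2 * R ^ 2)) := by
        gcongr
        exact mul_exp_neg_le one_half_pos (by positivity)
    _ = 16 / R ^ 2 := by field_simp; norm_num

lemma gaussianReal_Icc_mul_abs_sum_taylorCoef_sub_G_le (hβ : β ∈ Set.Icc 0 1) (hvw : v ≤ w)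
    (hw0 : (0 : ℝ) < w) (hw : 3 * (w : ℝ) < 1) (hlam : 0 ≤ lam) (hD : 0 < D)
    (hM : Real.exp 2 * (lam + D) ^ 2 ≤ M) :
    (gaussianReal μ v).real (Set.Icc (-lam) lam) *
        |∑ k ∈ Finset.range (M + 2), taylorCoef β k * μ ^ k - G μ β| ≤
      16 / (lam + D) ^ 2 + (M + 2) * Real.exp ((lam ^ 2 / (1 - 3 * w) - D ^ 2 / (2 * w)) / 2) +
        (w / D + (lam + 3) * w / D ^ 2) := by
  have hp : 0 ≤ (gaussianReal μ v).real (Set.Icc (-lam) lam) := measureReal_nonneg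
  rcases le_total |μ| (lam + D) with hμ | hμ
  · refine (mul_le_of_le_one_left (abs_nonneg _) measureReal_le_one).trans ?_
    refine (abs_sum_taylorCoef_sub_G_le_div μ β (by positivity) hμ hM).trans ?_
    rw [add_assoc]
    exact le_add_of_nonneg_right (by positivity)
  · refine (mul_le_mul_of_nonneg_left (abs_sub _ _) hp).trans ?_
    rw [mul_add, add_assoc]
    exact le_add_of_nonneg_of_le (by positivity)
      (add_le_add (gaussianReal_Icc_mul_abs_sum_taylorCoef_le μ hβ hvw hw0 hw hD.le hμ M)
        (gaussianReal_Icc_mul_abs_G_le μ hβ hvw hD hlam hμ))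

lemma abs_integral_hermiteEst_sub_G_le (hβ : β ∈ Set.Icc 0 1) (hvw : v ≤ w)
    (hw0 : (0 : ℝ) < w) (hw : 3 * (w : ℝ) < 1) (hlam : 0 < lam) (hn : 0 < n) (M : ℕ) :
    |∫ p, hermiteEst β lam n M v p ∂(gaussianReal μ v).prod (gaussianReal μ v) - G μ β| ≤
      12 * (1 + w) / lam + (M + 2) ^ 2 * Real.exp (lam ^ 2 / (1 - 3 * w)) / n +
        (gaussianReal μ v).real (Set.Icc (-lam) lam) *
          |∑ k ∈ Finset.range (M + 2), taylorCoef β k * μ ^ k - G μ β| := by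
  have hS := memLp_two_eval_gaussianReal μ v (hermiteSum (taylorCoef β) v (M + 2))
  have hp : 0 ≤ (gaussianReal μ v).real (Set.Icc (-lam) lam) := measureReal_nonneg
  have hclip := abs_integral_clip_sub_le hn hS
  rw [integral_hermiteSum] at hclip
  have hsub := abs_sub_le (∫ x, clip n ((hermiteSum (taylorCoef β) v (M + 2)).eval x)
    ∂gaussianReal μ v) (∑ k ∈ Finset.range (M + 2), taylorCoef β k * μ ^ k) (G μ β)
  refine (abs_integral_switchEst_sub_G_le μ v hlam
    ((memLp_two_clip hn.le hS).integrable one_le_two)).trans ?_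
  rw [add_assoc]
  refine add_le_add (by gcongr) ((mul_le_mul_of_nonneg_left
    (hsub.trans (add_le_add_left hclip _)) hp).trans ?_)
  rw [mul_add, ← mul_div_assoc]
  exact add_le_add_left (div_le_div_of_nonneg_right
    (gaussianReal_Icc_mul_integral_hermiteSum_sq_le μ hβ hvw hw0 hw lam M) hn.le) _

lemma variance_hermiteEst_le (hβ : β ∈ Set.Icc 0 1) (hvw : v ≤ w) (hw0 : (0 : ℝ) < w)
    (hw : 3 * (w : ℝ) < 1) (hlam : 0 ≤ lam) (hn : 0 ≤ n) (M : ℕ) :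
    variance (hermiteEst β lam n M v) ((gaussianReal μ v).prod (gaussianReal μ v)) ≤
      2 * ((M + 2) ^ 2 * Real.exp (lam ^ 2 / (1 - 3 * w))) + 4 * lam ^ 2 + 7 * w := by
  have hS := memLp_two_eval_gaussianReal μ v (hermiteSum (taylorCoef β) v (M + 2))
  have hsq := (mul_le_mul_of_nonneg_left (integral_clip_sq_le hn hS) measureReal_nonneg).trans
    (gaussianReal_Icc_mul_integral_hermiteSum_sq_le μ hβ hvw hw0 hw lam M)
  have : (v : ℝ) ≤ w := hvw
  exact (variance_switchEst_le μ v hβ hlam (memLp_two_clip hn hS)).trans (by linarith)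

end HermiteEstimate

section Balance

/-- The Taylor order `⌈e² (γ + √w)² y²⌉`, for the threshold `γ y` and a bound `w` on the variance;
`K_n - 1` is its value at `y = √(2 log n)`, `w = 2 σp / σf`. -/
def taylorOrder (γ w y : ℝ) : ℕ := ⌈Real.exp 2 * (γ + √w) ^ 2 * y ^ 2⌉₊

/-- The exponent `ε` with `exp (λ² / (1 - 3w)) = n exp (-2 ε y²)` when `λ = γ y` and
`n = exp (y² / 2)`. -/
def decayRate (γ w : ℝ) : ℝ := (1 - 2 * γ ^ 2 / (1 - 3 * w)) / 4

variable {γ w y : ℝ}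

lemma decayRate_pos (h : 2 * γ ^ 2 + 3 * w < 1) : 0 < decayRate γ w := by
  have hw3 : 0 < 1 - 3 * w := by nlinarith [sq_nonneg γ]
  have hlt : 2 * γ ^ 2 / (1 - 3 * w) < 1 := (div_lt_one hw3).2 (by linarith)
  exact div_pos (sub_pos.2 hlt) four_pos

lemma exp_threshold_sq_div_exp (γ w y : ℝ) :
    Real.exp ((γ * y) ^ 2 / (1 - 3 * w)) / Real.exp (y ^ 2 / 2) =
      Real.exp (-(decayRate γ w * y ^ 2)) ^ 2 := by
  rw [← Real.exp_sub, ← Real.exp_nat_mul, decayRate]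
  congr 1
  push_cast
  ring

lemma threshold_sq_sub_half_eq (hw : 0 < w) (γ y : ℝ) :
    ((γ * y) ^ 2 / (1 - 3 * w) - (√w * y) ^ 2 / (2 * w)) / 2 = -(decayRate γ w * y ^ 2) := by
  have hsq : (√w * y) ^ 2 / (2 * w) = y ^ 2 / 2 := by
    rw [mul_pow, Real.sq_sqrt hw.le]
    field_simp
  rw [hsq, decayRate]
  ring

/-- The constant in `taylorOrder_add_two_mul_exp_le`. -/
def orderConst (γ w : ℝ) : ℝ := 2 * (Real.exp 2 * (γ + √w) ^ 2 + 3) / decayRate γ w ^ 2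

lemma taylorOrder_add_two_mul_exp_le (h : 2 * γ ^ 2 + 3 * w < 1) (hy : 1 ≤ y) :
    (taylorOrder γ w y + 2) * Real.exp (-(decayRate γ w * y ^ 2)) ≤ orderConst γ w * y⁻¹ := by
  have hε := decayRate_pos h
  have hceil := (Nat.ceil_lt_add_one
    (by positivity : 0 ≤ Real.exp 2 * (γ + √w) ^ 2 * y ^ 2)).le
  have hy2 : 1 ≤ y ^ 2 := one_le_pow₀ hy
  calc (taylorOrder γ w y + 2) * Real.exp (-(decayRate γ w * y ^ 2))
      ≤ (Real.exp 2 * (γ + √w) ^ 2 + 3) * y ^ 2 * Real.exp (-(decayRate γ w * y ^ 2)) := by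
        gcongr
        rw [taylorOrder]
        linarith
    _ = (Real.exp 2 * (γ + √w) ^ 2 + 3) * (y ^ 2 * Real.exp (-(decayRate γ w * y ^ 2))) :=
        mul_assoc _ _ _
    _ ≤ (Real.exp 2 * (γ + √w) ^ 2 + 3) * (2 / (decayRate γ w ^ 2 * y ^ 2)) := by
        gcongr
        exact mul_exp_neg_le hε (by positivity)
    _ = orderConst γ w * (y ^ 2)⁻¹ := by
        rw [orderConst]
        ring
    _ ≤ orderConst γ w * y⁻¹ := by
        gcongr
        · rw [orderConst]
          positivity
        · exact le_self_pow₀ hy two_ne_zero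

lemma sq_taylorOrder_mul_exp_div_exp_le (h : 2 * γ ^ 2 + 3 * w < 1) (hy : 1 ≤ y) :
    (taylorOrder γ w y + 2) ^ 2 * Real.exp ((γ * y) ^ 2 / (1 - 3 * w)) / Real.exp (y ^ 2 / 2) ≤
      orderConst γ w ^ 2 * y⁻¹ := by
  rw [mul_div_assoc, exp_threshold_sq_div_exp, ← mul_pow]
  calc _ ≤ (orderConst γ w * y⁻¹) ^ 2 :=
        pow_le_pow_left₀ (by positivity) (taylorOrder_add_two_mul_exp_le h hy) 2
    _ = orderConst γ w ^ 2 * (y ^ 2)⁻¹ := by rw [mul_pow, inv_pow]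
    _ ≤ orderConst γ w ^ 2 * y⁻¹ := by
        gcongr
        exact le_self_pow₀ hy two_ne_zero

end Balance

section UniformRates

variable {γ β y : ℝ} {v w : ℝ≥0}

lemma gaussianReal_Icc_mul_abs_taylorOrder_sub_G_le (hγ : 0 < γ) (hw : (0 : ℝ) < w)
    (h : 2 * γ ^ 2 + 3 * w < 1) (hβ : β ∈ Set.Icc 0 1) (hy : 1 ≤ y) (hvw : v ≤ w) (μ : ℝ) :
    (gaussianReal μ v).real (Set.Icc (-(γ * y)) (γ * y)) *
        |∑ k ∈ Finset.range (taylorOrder γ w y + 2), taylorCoef β k * μ ^ k - G μ β| ≤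
      (16 / (γ + √w) ^ 2 + orderConst γ w + √w + γ + 3) * y⁻¹ := by
  have : 0 < √(w : ℝ) := Real.sqrt_pos.2 hw
  have hM : Real.exp 2 * (γ * y + √w * y) ^ 2 ≤ taylorOrder γ w y := by
    refine le_trans (le_of_eq ?_) (Nat.le_ceil _)
    ring
  have hy2 : y ≤ y ^ 2 := le_self_pow₀ hy two_ne_zero
  have hmid := gaussianReal_Icc_mul_abs_sum_taylorCoef_sub_G_le μ hβ hvw hw
    (by nlinarith [sq_nonneg γ]) (by positivity) (by positivity) hM
  rw [threshold_sq_sub_half_eq hw] at hmid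
  have hnear : 16 / (γ * y + √w * y) ^ 2 ≤ 16 / (γ + √w) ^ 2 * y⁻¹ := by
    rw [← add_mul, mul_pow, ← div_div, div_eq_mul_inv _ (y ^ 2)]
    gcongr
  have hslope : w / (√w * y) = √w * y⁻¹ := by
    rw [← div_div, Real.div_sqrt, div_eq_mul_inv]
  have hintercept : (γ * y + 3) * w / (√w * y) ^ 2 ≤ (γ + 3) * y⁻¹ := by
    rw [mul_pow, Real.sq_sqrt hw.le]
    field_simp
    nlinarith
  linarith [taylorOrder_add_two_mul_exp_le h hy]

/-- The constant in `abs_integral_hermiteEst_sub_G_le_inv`. -/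
def biasConst (γ w : ℝ) : ℝ :=
  12 * (1 + w) / γ + orderConst γ w ^ 2 +
    (16 / (γ + √w) ^ 2 + orderConst γ w + √w + γ + 3)

lemma abs_integral_hermiteEst_sub_G_le_inv (hγ : 0 < γ) (hw : (0 : ℝ) < w)
    (h : 2 * γ ^ 2 + 3 * w < 1) (hβ : β ∈ Set.Icc 0 1) (hy : 1 ≤ y) (hvw : v ≤ w) (μ : ℝ) :
    |∫ p, hermiteEst β (γ * y) (Real.exp (y ^ 2 / 2)) (taylorOrder γ w y) v p
        ∂(gaussianReal μ v).prod (gaussianReal μ v) - G μ β| ≤ biasConst γ w * y⁻¹ := by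
  have hthreshold : 12 * (1 + (w : ℝ)) / (γ * y) = 12 * (1 + w) / γ * y⁻¹ := by
    rw [← div_div, div_eq_mul_inv _ y]
  refine (abs_integral_hermiteEst_sub_G_le μ hβ hvw hw (by nlinarith [sq_nonneg γ])
    (by positivity) (Real.exp_pos _) _).trans ?_
  rw [hthreshold, biasConst, add_mul, add_mul]
  exact add_le_add (add_le_add_right (sq_taylorOrder_mul_exp_div_exp_le h hy) _)
    (gaussianReal_Icc_mul_abs_taylorOrder_sub_G_le hγ hw h hβ hy hvw μ)

lemma variance_hermiteEst_div_exp_le_inv (hγ : 0 ≤ γ) (hw : (0 : ℝ) < w)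
    (h : 2 * γ ^ 2 + 3 * w < 1) (hβ : β ∈ Set.Icc 0 1) (hy : 1 ≤ y) (hvw : v ≤ w) (μ : ℝ) :
    variance (hermiteEst β (γ * y) (Real.exp (y ^ 2 / 2)) (taylorOrder γ w y) v)
        ((gaussianReal μ v).prod (gaussianReal μ v)) / Real.exp (y ^ 2 / 2) ≤
      (2 * orderConst γ w ^ 2 + 8 * (4 * γ ^ 2 + 7 * w)) * y⁻¹ := by
  have hvar := variance_hermiteEst_le μ hβ hvw hw (by nlinarith [sq_nonneg γ])
    (by positivity : 0 ≤ γ * y) (Real.exp_pos (y ^ 2 / 2)).le (taylorOrder γ w y)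
  have hdecay : y ^ 2 / Real.exp (y ^ 2 / 2) ≤ 8 * y⁻¹ := by
    calc y ^ 2 / Real.exp (y ^ 2 / 2) = y ^ 2 * Real.exp (-(1 / 2 * y ^ 2)) := by
          rw [div_eq_mul_inv, ← Real.exp_neg]
          ring_nf
      _ ≤ 2 / ((1 / 2) ^ 2 * y ^ 2) := mul_exp_neg_le one_half_pos (by positivity)
      _ = 8 * (y ^ 2)⁻¹ := by ring
      _ ≤ 8 * y⁻¹ := by
          gcongr
          exact le_self_pow₀ hy two_ne_zero
  have hrest : 4 * (γ * y) ^ 2 + 7 * (w : ℝ) ≤ (4 * γ ^ 2 + 7 * w) * y ^ 2 := by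
    nlinarith [mul_le_mul_of_nonneg_left (one_le_pow₀ hy : 1 ≤ y ^ 2) hw.le]
  calc _ ≤ (2 * ((taylorOrder γ w y + 2) ^ 2 * Real.exp ((γ * y) ^ 2 / (1 - 3 * w))) +
        (4 * γ ^ 2 + 7 * w) * y ^ 2) / Real.exp (y ^ 2 / 2) := by
        gcongr
        linarith
    _ = 2 * ((taylorOrder γ w y + 2) ^ 2 * Real.exp ((γ * y) ^ 2 / (1 - 3 * w)) /
          Real.exp (y ^ 2 / 2)) + (4 * γ ^ 2 + 7 * w) * (y ^ 2 / Real.exp (y ^ 2 / 2)) := by ring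
    _ ≤ 2 * (orderConst γ w ^ 2 * y⁻¹) + (4 * γ ^ 2 + 7 * w) * (8 * y⁻¹) := by
        gcongr
        exact sq_taylorOrder_mul_exp_div_exp_le h hy
    _ = _ := by ring

end UniformRates

section Reduction

/-- Common mean of the independent copies `U(τ)` and `V(τ)`. -/
def splitMean (σp σf β : ℝ) (τ : ℝ≥0∞) (θ : ℝ) : ℝ := coefC σp σf β τ + coefD σp σf τ * θ

/-- Common variance `v(τ)` of the independent copies `U(τ)` and `V(τ)`. -/
def splitVar (σp σf : ℝ) (τ : ℝ≥0∞) : ℝ≥0 := (2 * σp * coefD σp σf τ ^ 2).toNNReal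

/-- Joint law of the independent copies `U(τ)` and `V(τ)`. -/
def splitLaw (σp σf β : ℝ) (τ : ℝ≥0∞) (θ : ℝ) : Measure (ℝ × ℝ) :=
  (gaussianReal (splitMean σp σf β τ θ) (splitVar σp σf τ)).prod
    (gaussianReal (splitMean σp σf β τ θ) (splitVar σp σf τ))

variable {σp σf : ℝ}

lemma coe_splitVar (hσp : 0 ≤ σp) (σf : ℝ) (τ : ℝ≥0∞) :
    (splitVar σp σf τ : ℝ) = 2 * σp * coefD σp σf τ ^ 2 :=
  Real.coe_toNNReal _ (by positivity)

lemma shrink_mem_Icc (hσp : 0 ≤ σp) (τ : ℝ≥0∞) : shrink σp τ ∈ Set.Icc 0 1 := by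
  unfold shrink
  split_ifs
  · simp
  · have : 0 ≤ τ.toReal := ENNReal.toReal_nonneg
    exact ⟨by positivity, div_le_one_of_le₀ (by linarith) (by positivity)⟩

lemma splitVar_le (hσp : 0 ≤ σp) (hσf : 0 < σf) (τ : ℝ≥0∞) :
    (splitVar σp σf τ : ℝ) ≤ 2 * σp / σf := by
  obtain ⟨h0, h1⟩ := shrink_mem_Icc hσp τ
  have hden : 0 < σf + σp * shrink σp τ ^ 2 := by positivity
  rw [coe_splitVar hσp, coefD, neg_sq, div_pow, Real.sq_sqrt hden.le, ← mul_div_assoc]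
  refine div_le_div₀ (by positivity) (mul_le_of_le_one_right (by positivity) ?_) hσf
    (le_add_of_nonneg_right (by positivity))
  exact pow_le_one₀ (by linarith) (by linarith)

lemma hasLaw_splitU_splitV (hσp : 0 ≤ σp) (σf β θ : ℝ) (τ : ℝ≥0∞) :
    HasLaw (fun p : ℝ × ℝ => (splitU σp σf β τ p.1 p.2, splitV σp σf β τ p.1 p.2))
      (splitLaw σp σf β τ θ) (coordLaw σp θ) :=
  hasLaw_split_coordLaw hσp θ (coefC σp σf β τ) (coefD σp σf τ)

lemma sum_taylorCoef_mul (β : ℝ) (M : ℕ) (f : ℕ → ℝ) :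
    ∑ k ∈ Finset.range (M + 2), taylorCoef β k * f k = G 0 β * f 0 + (stdCDF 0 - β) * f 1 +
      stdPDF 0 * ∑ k ∈ Finset.range M,
        (-1) ^ k * hermiteVal k 0 / ((k + 2).factorial : ℝ) * f (k + 2) := by
  rw [Finset.sum_range_succ', Finset.sum_range_succ', Finset.mul_sum]
  simp only [taylorCoef, zero_add, mul_assoc]
  ring

lemma seriesEst_eq_eval_hermiteSum (hσp : 0 ≤ σp) (γ σf β : ℝ) (n : ℕ) (τ : ℝ≥0∞) (u : ℝ) :
    seriesEst γ σp σf β n τ u = (hermiteSum (taylorCoef β) (splitVar σp σf τ)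
      (truncOrder γ σp σf n - 1 + 2)).eval u := by
  simp only [hermiteSum, Polynomial.eval_finsetSum, Polynomial.eval_mul, Polynomial.eval_C]
  rw [sum_taylorCoef_mul, seriesEst, (hasDerivAt_G β 0).deriv, ← coe_splitVar hσp]
  simp only [scaledHermite_eq_eval (splitVar σp σf τ).coe_nonneg]
  simp [scaledHermitePoly]

lemma thresholdEst_eq_hermiteEst (hσp : 0 ≤ σp) (γ σf β : ℝ) (n : ℕ) (τ : ℝ≥0∞) (p : ℝ × ℝ) :
    thresholdEst γ σp σf β n τ p.1 p.2 =
      hermiteEst β (threshold γ n) n (truncOrder γ σp σf n - 1) (splitVar σp σf τ)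
        (splitU σp σf β τ p.1 p.2, splitV σp σf β τ p.1 p.2) := by
  simp only [thresholdEst, truncEst, seriesEst_eq_eval_hermiteSum hσp]
  rfl

variable {γ : ℝ}

lemma memLp_two_hermiteEst_splitLaw (hγ : 0 ≤ γ) (σp σf β : ℝ) (n : ℕ) (τ : ℝ≥0∞) (θ : ℝ) :
    MemLp (hermiteEst β (threshold γ n) n (truncOrder γ σp σf n - 1) (splitVar σp σf τ)) 2
      (splitLaw σp σf β τ θ) :=
  memLp_two_hermiteEst _ (mul_nonneg hγ (Real.sqrt_nonneg _)) n.cast_nonneg _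

theorem memLp_two_thresholdEst (hσp : 0 ≤ σp) (hγ : 0 ≤ γ) (σf β : ℝ) (n : ℕ) (τ : ℝ≥0∞) (θ : ℝ) :
    MemLp (fun p : ℝ × ℝ => thresholdEst γ σp σf β n τ p.1 p.2) 2 (coordLaw σp θ) := by
  have hlaw := hasLaw_splitU_splitV hσp σf β θ τ
  have hmem := memLp_two_hermiteEst_splitLaw hγ σp σf β n τ θ
  rw [← hlaw.map_eq] at hmem
  simp_rw [thresholdEst_eq_hermiteEst hσp]
  exact hmem.comp_of_map hlaw.aemeasurable

lemma bias_eq_integral_hermiteEst_sub (hσp : 0 ≤ σp) (hγ : 0 ≤ γ) (σf β : ℝ) (n : ℕ) (τ : ℝ≥0∞)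
    (θ : ℝ) :
    bias γ σp σf β n τ θ = ∫ p, hermiteEst β (threshold γ n) n (truncOrder γ σp σf n - 1)
      (splitVar σp σf τ) p ∂splitLaw σp σf β τ θ - G (splitMean σp σf β τ θ) β := by
  rw [← (hasLaw_splitU_splitV hσp σf β θ τ).integral_comp
    (memLp_two_hermiteEst_splitLaw hγ σp σf β n τ θ).aestronglyMeasurable, bias]
  simp_rw [thresholdEst_eq_hermiteEst hσp]
  rfl

lemma estVar_eq_variance_hermiteEst (hσp : 0 ≤ σp) (hγ : 0 ≤ γ) (σf β : ℝ) (n : ℕ) (τ : ℝ≥0∞)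
    (θ : ℝ) :
    estVar γ σp σf β n τ θ = variance (hermiteEst β (threshold γ n) n (truncOrder γ σp σf n - 1)
      (splitVar σp σf τ)) (splitLaw σp σf β τ θ) := by
  have hlaw := hasLaw_splitU_splitV hσp σf β θ τ
  have hmem := memLp_two_hermiteEst_splitLaw hγ σp σf β n τ θ
  rw [← hlaw.map_eq] at hmem ⊢
  rw [variance_map hmem.aestronglyMeasurable.aemeasurable hlaw.aemeasurable, estVar]
  simp_rw [thresholdEst_eq_hermiteEst hσp]
  rfl

lemma truncOrder_sub_one (γ σp σf : ℝ) (n : ℕ) :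
    truncOrder γ σp σf n - 1 = taylorOrder γ (2 * σp / σf) √(2 * Real.log n) := by
  have hlog : 0 ≤ 2 * Real.log n := mul_nonneg two_pos.le (Real.log_natCast_nonneg n)
  rw [truncOrder, Nat.add_sub_cancel_left, taylorOrder, Real.sq_sqrt hlog, Real.exp_one_pow]
  norm_cast

lemma exp_sq_sqrt_two_mul_log_div_two {n : ℕ} (hn : n ≠ 0) :
    Real.exp (√(2 * Real.log n) ^ 2 / 2) = n := by
  rw [Real.sq_sqrt (mul_nonneg two_pos.le (Real.log_natCast_nonneg n)),
    mul_div_cancel_left₀ _ two_ne_zero, Real.exp_log (by positivity)]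

end Reduction

section Limits

lemma tendsto_log_natCast_atTop : Tendsto (fun n : ℕ => Real.log n) atTop atTop :=
  Real.tendsto_log_atTop.comp tendsto_natCast_atTop_atTop

lemma tendsto_rate_pow_mul_inv_sqrt_log :
    Tendsto (fun n : ℕ => rate n ^ 8 * (√(2 * Real.log n))⁻¹) atTop (𝓝 0) := by
  have hlog := (Real.tendsto_pow_log_div_mul_add_atTop 2 0 16 two_ne_zero).sqrt
  rw [Real.sqrt_zero] at hlog
  refine (hlog.comp tendsto_log_natCast_atTop).congr fun n => ?_
  have hsq : Real.log (Real.log n) ^ 16 = (rate n ^ 8) ^ 2 := by rw [rate, ← pow_mul]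
  rw [Function.comp_apply, add_zero, hsq, Real.sqrt_div (sq_nonneg _),
    Real.sqrt_sq (Even.pow_nonneg (by decide) _), div_eq_mul_inv]

lemma eventually_one_le_sqrt_two_mul_log :
    ∀ᶠ n : ℕ in atTop, n ≠ 0 ∧ 1 ≤ √(2 * Real.log n) :=
  (eventually_ne_atTop 0).and ((Real.tendsto_sqrt_atTop.comp
    (tendsto_log_natCast_atTop.const_mul_atTop two_pos)).eventually_ge_atTop 1)

lemma tendsto_iSup_rate_pow_mul {ι κ : Type*} {F : ℕ → ι → κ → ℝ} (C : ℝ)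
    (hF : ∀ n : ℕ, n ≠ 0 → 1 ≤ √(2 * Real.log n) →
      ∀ i j, F n i j ≤ C * (√(2 * Real.log n))⁻¹) :
    Tendsto (fun n => ⨆ (i : ι) (j : κ), ENNReal.ofReal (rate n ^ 8 * F n i j)) atTop (𝓝 0) := by
  have hbound := ENNReal.tendsto_ofReal (tendsto_rate_pow_mul_inv_sqrt_log.const_mul C)
  rw [mul_zero, ENNReal.ofReal_zero] at hbound
  refine tendsto_of_tendsto_of_tendsto_of_le_of_le' tendsto_const_nhds hbound
    (Eventually.of_forall fun _ => zero_le) ?_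
  filter_upwards [eventually_one_le_sqrt_two_mul_log] with n ⟨hn, hy⟩
  refine iSup_le fun i => iSup_le fun j => ENNReal.ofReal_le_ofReal ?_
  rw [mul_left_comm]
  exact mul_le_mul_of_nonneg_left (hF n hn hy i j) (Even.pow_nonneg (by decide) _)

variable {σp σf γ β : ℝ}

theorem abs_bias_le (hσp : 0 < σp) (hσf : 0 < σf) (hγ : 0 < γ) (hβ : β ∈ Set.Icc 0 1)
    (h : 2 * γ ^ 2 + 6 * (σp / σf) < 1) {n : ℕ} (hn : n ≠ 0) (hy : 1 ≤ √(2 * Real.log n))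
    (τ : ℝ≥0∞) (θ : ℝ) :
    |bias γ σp σf β n τ θ| ≤ biasConst γ (2 * σp / σf) * (√(2 * Real.log n))⁻¹ := by
  obtain ⟨w, hw⟩ : ∃ w : ℝ≥0, (w : ℝ) = 2 * σp / σf := ⟨⟨_, by positivity⟩, rfl⟩
  have hbound := abs_integral_hermiteEst_sub_G_le_inv (w := w) hγ (by rw [hw]; positivity)
    (by rw [hw]; linarith [mul_div_assoc 2 σp σf]) hβ hy
    (NNReal.coe_le_coe.1 (hw ▸ splitVar_le hσp.le hσf τ)) (splitMean σp σf β τ θ)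
  rw [exp_sq_sqrt_two_mul_log_div_two hn, hw, ← truncOrder_sub_one] at hbound
  rw [bias_eq_integral_hermiteEst_sub hσp.le hγ.le]
  exact hbound

theorem inv_mul_estVar_le (hσp : 0 < σp) (hσf : 0 < σf) (hγ : 0 ≤ γ) (hβ : β ∈ Set.Icc 0 1)
    (h : 2 * γ ^ 2 + 6 * (σp / σf) < 1) {n : ℕ} (hn : n ≠ 0) (hy : 1 ≤ √(2 * Real.log n))
    (τ : ℝ≥0∞) (θ : ℝ) :
    (n : ℝ)⁻¹ * estVar γ σp σf β n τ θ ≤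
      (2 * orderConst γ (2 * σp / σf) ^ 2 + 8 * (4 * γ ^ 2 + 7 * (2 * σp / σf))) *
        (√(2 * Real.log n))⁻¹ := by
  obtain ⟨w, hw⟩ : ∃ w : ℝ≥0, (w : ℝ) = 2 * σp / σf := ⟨⟨_, by positivity⟩, rfl⟩
  have hbound := variance_hermiteEst_div_exp_le_inv (w := w) hγ (by rw [hw]; positivity)
    (by rw [hw]; linarith [mul_div_assoc 2 σp σf]) hβ hy
    (NNReal.coe_le_coe.1 (hw ▸ splitVar_le hσp.le hσf τ)) (splitMean σp σf β τ θ)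
  rw [exp_sq_sqrt_two_mul_log_div_two hn, hw, ← truncOrder_sub_one] at hbound
  rw [estVar_eq_variance_hermiteEst hσp.le hγ, inv_mul_eq_div]
  exact hbound

end Limits

section Parameters

lemma bTilde_mem_Ioo {b h : ℝ} (hb : 0 < b) (hh : 0 < h) : bTilde b h ∈ Set.Ioo 0 1 :=
  ⟨by unfold bTilde; positivity, (div_lt_one (by positivity)).2 (by linarith)⟩

lemma SufficientHistory.pastVar_pos {σp σf : ℕ → ℝ} (hσ : SufficientHistory σp σf) (i : ℕ) :
    0 < σp i :=
  let ⟨_, hm, hle⟩ := hσ.2.2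
  hm.trans_le (hle i)

lemma two_mul_sq_add_six_mul_lt_one {γ r : ℝ} (hγ : 0 ≤ γ) (hr : 0 ≤ r)
    (h : γ < 1 / √(4 * Real.exp 1) - √r) : 2 * γ ^ 2 + 6 * r < 1 := by
  have hsq : (γ + √r) ^ 2 < 1 / (4 * Real.exp 1) := by
    rw [← Real.lt_sqrt (by positivity), Real.sqrt_div one_pos.le, Real.sqrt_one]
    linarith
  have he : 1 / (4 * Real.exp 1) < 1 / 6 :=
    one_div_lt_one_div_of_lt (by norm_num) (by linarith [Real.exp_one_gt_d9])
  nlinarith [Real.sq_sqrt hr, mul_nonneg hγ (Real.sqrt_nonneg r)]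

end Parameters

end CheckLoss

end

theorem mainTheorem2_general {σp σf γ β : ℝ} (hσp : 0 < σp) (hσf : 0 < σf) (hγ : 0 < γ)
    (hβ : β ∈ Set.Ioo 0 1) (h : 2 * γ ^ 2 + 6 * (σp / σf) < 1) :
    (∀ (n : ℕ) (τ : ℝ≥0∞) (θ : ℝ),
      MemLp (fun p : ℝ × ℝ => CheckLoss.thresholdEst γ σp σf β n τ p.1 p.2) 2
        (CheckLoss.coordLaw σp θ)) ∧
    Tendsto (fun n : ℕ => ⨆ (τ : ℝ≥0∞) (θ : ℝ),
        ENNReal.ofReal (CheckLoss.rate n ^ 8 * |CheckLoss.bias γ σp σf β n τ θ|))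
      atTop (𝓝 0) ∧
    Tendsto (fun n : ℕ => ⨆ (τ : ℝ≥0∞) (θ : ℝ),
        ENNReal.ofReal ((n : ℝ)⁻¹ * CheckLoss.rate n ^ 8 * CheckLoss.estVar γ σp σf β n τ θ))
      atTop (𝓝 0) := by
  have hβ' := Set.Ioo_subset_Icc_self hβ
  refine ⟨CheckLoss.memLp_two_thresholdEst hσp.le hγ.le σf β,
    CheckLoss.tendsto_iSup_rate_pow_mul _ fun n hn hy =>
      CheckLoss.abs_bias_le hσp hσf hγ hβ' h hn hy, ?_⟩
  simp_rw [mul_comm _ (CheckLoss.rate _ ^ 8), mul_assoc]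
  exact CheckLoss.tendsto_iSup_rate_pow_mul _ fun n hn hy =>
    CheckLoss.inv_mul_estVar_le hσp hσf hγ.le hβ' h hn hy

theorem mainTheorem2 (b h σp σf γ : ℕ → ℝ)
    (hb : ∀ i, 0 < b i) (hh : ∀ i, 0 < h i) (hσf : ∀ i, 0 < σf i)
    (hA1 : CheckLoss.BoundedWeights b h)
    (hA3 : CheckLoss.SufficientHistory σp σf)
    (hγ : ∀ i, 0 < γ i ∧ γ i < 1 / √(4 * Real.exp 1) - √(σp i / σf i))
    (i : ℕ) :
    (∀ (n : ℕ) (τ : ℝ≥0∞) (θ : ℝ),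
      MemLp (fun p : ℝ × ℝ => CheckLoss.thresholdEst (γ i) (σp i) (σf i)
        (CheckLoss.bTilde (b i) (h i)) n τ p.1 p.2) 2 (CheckLoss.coordLaw (σp i) θ)) ∧
    Tendsto (fun n : ℕ => ⨆ (τ : ℝ≥0∞) (θ : ℝ), ENNReal.ofReal (CheckLoss.rate n ^ 8 *
        |CheckLoss.bias (γ i) (σp i) (σf i) (CheckLoss.bTilde (b i) (h i)) n τ θ|))
      atTop (𝓝 0) ∧
    Tendsto (fun n : ℕ => ⨆ (τ : ℝ≥0∞) (θ : ℝ), ENNReal.ofReal ((n : ℝ)⁻¹ *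
        CheckLoss.rate n ^ 8 *
        CheckLoss.estVar (γ i) (σp i) (σf i) (CheckLoss.bTilde (b i) (h i)) n τ θ))
      atTop (𝓝 0) :=
  have hσp := hA3.pastVar_pos i
  mainTheorem2_general hσp (hσf i) (hγ i).1 (CheckLoss.bTilde_mem_Ioo (hb i) (hh i))
    (CheckLoss.two_mul_sq_add_six_mul_lt_one (hγ i).1.le (div_pos hσp (hσf i)).le (hγ i).2)
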